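/- Let $n\ge 0$. A *loop* is a meromorphic (i.e. rational) function $\phi$ on the Riemann sphere with values in the $n\times n$ matrices, invertible as a matrix of meromorphic functions, unitary on the real axis and with $\phi(\infty)=1$. Let $G$ (resp. $M$) be the set of loops with no singularities in $\operatorname{Im}\lambda>0$ (resp. $\operatorname{Im}\lambda<0$), and $J_G\subset G$, $J_M\subset M$ the subsets of loops that are a scalar function times the identity. For $\alpha\in\mathbb C\setminus\mathbb R$ and a self-adjoint projection $P$, put $P^\perp=1-P$, $\theta_\alpha(\lambda)=(\lambda-\bar\alpha)/(\lambda-\alpha)$, $\Phi_{\alpha,P}=P^{\perp}+\theta_\alpha P$ (a basic loop) and $\Phi_{\alpha,P}^i=\theta_\alpha P^\perp+P$. For a loop $x$, an $x^i$ is obtained from a factorisation $x=\Phi_1\cdots\Phi_k$ into the minimum number of basic loops as $x^i=\Phi_k^i\cdots\Phi_1^i$. For $s\in M$, $u\in G$, the elements $s\triangleright u\in G$ and $s\triangleleft u\in M$ are given by a factorisation $su=(s\triangleright u)(s\triangleleft u)$ with the minimum total number of basic factors. Call a loop *generic* if all its poles are simple and no two of them are complex conjugate. Let $D$ be the set of $(s,u)\in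 M\times G$ with $s,u$ generic and no pole of $s$ conjugate to a pole of $u$. Say that a loop has no scalar factor if none of its residues is invertible. Then: 1. (Densely defined operations.) $x^i$ exists for every loop and is unique for generic $x$; $(s\triangleright u,s\triangleleft u)$ exists for every $(s,u)\in M\times G$ and is unique for $(s,u)\in D$. $D$ is dense in $M\times G$ for uniform convergence on the real axis, and so is, if $n\ge2$, the set of $(s,u)\in D$ for which $s$ and $u$ have no scalar factor. 2. (Almost groups.) Let $(S,J)$ be $(G,J_G)$ or $(M,J_M)$. $S$ and its subset $J$ are closed under multiplication, and elements of $J$ commute with elements of $S$. For generic $g\in S$, $g^i\in S$ is generic, $gg^i=g^ig\in J$, and $g^i\in J$ if $g\in J$. $(gh)^i=h^ig^i$ for generic $g,h\in S$ without common poles. On the generic $g\in S$ without scalar factor, $i$ is a bijection of this set to itself with $(g^i)^i=g$. 3. (Matched pair.) For $s,t\in M$ and $u,v\in G$: if $(s,uv)\in D$, then $(s,u),(s\triangleleft u,v)\in D$, $s\triangleleft uv=(s\triangleleft u)\triangleleft v$ and $s\triangleright uv=(s\triangleright u)((s\triangleleft u)\triangleright v)$; if $(st,u)\in D$, then $(t,u),(s,t\triangleright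 u)\in D$, $st\triangleright u=s\triangleright(t\triangleright u)$ and $st\triangleleft u=(s\triangleleft(t\triangleright u))(t\triangleleft u)$; if $(s,u)\in D$, then $((s\triangleleft u)^i,(s\triangleright u)^i)\in D$, $(s\triangleleft u)^i\triangleright(s\triangleright u)^i=u^i$ and $(s\triangleleft u)^i\triangleleft(s\triangleright u)^i=s^i$; if $(s,u)\in D$ and $s\in J_M$ or $u\in J_G$, then $s\triangleright u=u$ and $s\triangleleft u=s$. 4. (Mutually inverse.) (a) The doublecross product is the group of loops: the loops form a group under pointwise multiplication, $(u,s)\mapsto us$ maps $G\times M$ onto it and maps $\{(u,s):(s,u)\in D\}$ bijectively onto the generic loops; it carries the doublecross product $(u,s)(v,t)=(u(s\triangleright v),(s\triangleleft v)t)$ to $(us)(vt)$ whenever $(s,v)\in D$, and $(u,s)^i=(s^i\triangleright u^i,s^i\triangleleft u^i)$ to $(us)^i$ whenever $(s,u)\in D$. (b) $s^{-1}\in G$ for all $s\in M$ and $u^{-1}\in M$ for all $u\in G$. (c) Inversion is a bijection $J_G\to J_M$. (d) If a loop $x$ is generic, so is $x^{-1}$, and $(x^{-1})^i=(x^i)^{-1}$.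 For an arbitrary loop $x$, the possible values of $(x^{-1})^i$ are the inverses of the possible values of $x^i$. (e) If $(s,u)\in D$, then $(u^{-1},s^{-1})\in D$, $u^{-1}\triangleright s^{-1}=(s\triangleleft u)^{-1}$ and $u^{-1}\triangleleft s^{-1}=(s\triangleright u)^{-1}$. For arbitrary $(s,u)\in M\times G$, the possible values of $(u^{-1}\triangleright s^{-1},u^{-1}\triangleleft s^{-1})$ are the pairs $((s\triangleleft u)^{-1},(s\triangleright u)^{-1})$ for the possible values of $(s\triangleright u,s\triangleleft u)$. -/

import Mathlib

open scoped Topology ComplexConjugate Matrix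

namespace MeroLoop

noncomputable section

/-- Invertible `n × n` matrices of meromorphic functions on the Riemann sphere.  The field of
meromorphic functions on the Riemann sphere is the field `ℂ(λ)` of rational functions. -/
abbrev Mero (n : ℕ) : Type := GL (Fin n) (RatFunc ℂ)

variable {n : ℕ}

/-- The value of `φ` at `a : ℂ` (meaningful where `φ` has no pole). -/
def valueAt (φ : Mero n) (a : ℂ) : Matrix (Fin n) (Fin n) ℂ :=
  fun k l => RatFunc.eval (RingHom.id ℂ) a (φ.val k l)

/-- `f` has a pole at `a`: the reduced denominator vanishes there. -/
def ScalarPole (f : RatFunc ℂ) (a : ℂ) : Prop := f.denom.eval a = 0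

/-- `φ` has a pole (singularity) at `a ∈ ℂ`. -/
def HasPole (φ : Mero n) (a : ℂ) : Prop := ∃ k l, ScalarPole (φ.val k l) a

/-- The pole of `φ` at `a` has order at most one. -/
def SimplePole (φ : Mero n) (a : ℂ) : Prop :=
  ∀ k l, ¬ ScalarPole ((RatFunc.X - RatFunc.C a) * φ.val k l) a

/-- The residue of `φ` at a simple pole `a`. -/
def residue (φ : Mero n) (a : ℂ) : Matrix (Fin n) (Fin n) ℂ :=
  fun k l => RatFunc.eval (RingHom.id ℂ) a ((RatFunc.X - RatFunc.C a) * φ.val k l)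

/-- The meromorphic loops: unitary on the real axis, with value `1` at `∞`. -/
def loops (n : ℕ) : Set (Mero n) :=
  {φ | (∀ t : ℝ, ¬ HasPole φ (t : ℂ) ∧ valueAt φ (t : ℂ) ∈ Matrix.unitaryGroup (Fin n) ℂ) ∧
    Filter.Tendsto (valueAt φ) (Filter.cocompact ℂ) (𝓝 1)}

/-- Loops without singularities in the upper half plane. -/
def setG (n : ℕ) : Set (Mero n) := {φ | φ ∈ loops n ∧ ∀ a : ℂ, 0 < a.im → ¬ HasPole φ a}

/-- Loops without singularities in the lower half plane. -/
def setM (n : ℕ) : Set (Mero n) := {φ | φ ∈ loops n ∧ ∀ a : ℂ, a.im < 0 → ¬ HasPole φ a}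

/-- `φ` is a scalar function times the identity matrix. -/
def IsScalar (φ : Mero n) : Prop := ∃ f : RatFunc ℂ, φ.val = Matrix.scalar (Fin n) f

def setJG (n : ℕ) : Set (Mero n) := {φ | φ ∈ setG n ∧ IsScalar φ}

def setJM (n : ℕ) : Set (Mero n) := {φ | φ ∈ setM n ∧ IsScalar φ}

/-! ### Basic loops and the operation `i` -/

/-- `θ_α(λ) = (λ - conj α) / (λ - α)`. -/
def theta (α : ℂ) : RatFunc ℂ :=
  (RatFunc.X - RatFunc.C (conj α)) / (RatFunc.X - RatFunc.C α)

/-- `Φ_{α,P} = P^⊥ + θ_α P`, for `p = (α, P)`. -/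
def basicLoop (p : ℂ × Matrix (Fin n) (Fin n) ℂ) : Matrix (Fin n) (Fin n) (RatFunc ℂ) :=
  (1 - p.2).map RatFunc.C + theta p.1 • p.2.map RatFunc.C

/-- `Φ_{α,P}^i = θ_α P^⊥ + P`, for `p = (α, P)`. -/
def basicLoopI (p : ℂ × Matrix (Fin n) (Fin n) ℂ) : Matrix (Fin n) (Fin n) (RatFunc ℂ) :=
  theta p.1 • (1 - p.2).map RatFunc.C + p.2.map RatFunc.C

/-- `α` is not real and `P` is a self-adjoint projection. -/
def ValidPair (p : ℂ × Matrix (Fin n) (Fin n) ℂ) : Prop :=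
  p.1.im ≠ 0 ∧ p.2.IsHermitian ∧ p.2 * p.2 = p.2

/-- The list `l` is a factorisation of `φ` as a product of basic loops. -/
def IsFactorisation (l : List (ℂ × Matrix (Fin n) (Fin n) ℂ)) (φ : Mero n) : Prop :=
  (∀ p ∈ l, ValidPair p) ∧ φ.val = (l.map basicLoop).prod

/-- `l` is a factorisation of `φ` with the minimum number of basic factors. -/
def IsMinFactorisation (l : List (ℂ × Matrix (Fin n) (Fin n) ℂ)) (φ : Mero n) : Prop :=
  IsFactorisation l φ ∧ ∀ l', IsFactorisation l' φ → l.length ≤ l'.length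

/-- `ψ` is obtained from `φ` by applying `i` to each factor of a minimal factorisation of `φ` and
reversing the order. -/
def IsIImage (φ ψ : Mero n) : Prop :=
  ∃ l, IsMinFactorisation l φ ∧ ψ.val = (l.reverse.map basicLoopI).prod

/-- The operation `i` (a choice of `i`-image where that is not unique). -/
def iOp (φ : Mero n) : Mero n := Classical.epsilon (IsIImage φ)

/-! ### The actions -/

/-- `x = u s` with `u ∈ G` and `s ∈ M` written with `k` basic factors in total. -/
def FactorsGM (x u s : Mero n) (k : ℕ) : Prop :=
  u ∈ setG n ∧ s ∈ setM n ∧ x = u * s ∧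
    ∃ lu ls, IsFactorisation lu u ∧ IsFactorisation ls s ∧ lu.length + ls.length = k

/-- `x = u s` is a factorisation with `u ∈ G`, `s ∈ M` and the minimum number of basic factors. -/
def IsMinFactorsGM (x u s : Mero n) : Prop :=
  ∃ k, FactorsGM x u s k ∧ ∀ u' s' k', FactorsGM x u' s' k' → k ≤ k'

/-- The pair `(s ▷ u, s ◁ u)` with `s u = (s ▷ u) (s ◁ u)` (a choice where it is not unique). -/
def actions (s u : Mero n) : Mero n × Mero n :=
  Classical.epsilon fun p => IsMinFactorsGM (s * u) p.1 p.2

/-- `s ▷ u`. -/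
def lact (s u : Mero n) : Mero n := (actions s u).1

/-- `s ◁ u`. -/
def ract (s u : Mero n) : Mero n := (actions s u).2

/-! ### The dense set on which the operations are defined -/

/-- No multiple poles, and no two poles at complex conjugate positions. -/
def Generic (φ : Mero n) : Prop :=
  ∀ a, HasPole φ a → SimplePole φ a ∧ ¬ HasPole φ (conj a)

/-- No pole of `φ` coincides with, or is complex conjugate to, a pole of `ψ`. -/
def Separated (φ ψ : Mero n) : Prop :=
  ∀ a b, HasPole φ a → HasPole ψ b → a ≠ b ∧ a ≠ conj b

/-- No residue of `φ` is invertible, i.e. no basic factor of `φ` is a scalar function `θ_α`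
times the identity matrix. -/
def NoScalarFactor (φ : Mero n) : Prop := ∀ a, HasPole φ a → (residue φ a).det = 0

/-- The pairs `(s, u) ∈ M × G` on which the actions are considered. -/
def InDomain (s u : Mero n) : Prop :=
  s ∈ setM n ∧ u ∈ setG n ∧ Generic s ∧ Generic u ∧ Separated s u

/-- `φ` and `ψ` are uniformly `ε`-close on the real axis. -/
def CloseOnReal (ε : ℝ) (φ ψ : Mero n) : Prop :=
  ∀ (t : ℝ) (k l : Fin n), ‖valueAt φ (t : ℂ) k l - valueAt ψ (t : ℂ) k l‖ < ε

/-- The operations are defined without ambiguity on a dense set. -/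
structure OperationsDenselyDefined (n : ℕ) : Prop where
  exists_i : ∀ x ∈ loops n, ∃ y, IsIImage x y
  unique_i : ∀ x ∈ loops n, Generic x → ∃! y, IsIImage x y
  exists_act : ∀ s ∈ setM n, ∀ u ∈ setG n,
    ∃ p : Mero n × Mero n, IsMinFactorsGM (s * u) p.1 p.2
  unique_act : ∀ s u : Mero n, InDomain s u →
    ∃! p : Mero n × Mero n, IsMinFactorsGM (s * u) p.1 p.2
  dense : ∀ s ∈ setM n, ∀ u ∈ setG n, ∀ ε : ℝ, 0 < ε →
    ∃ s' u', InDomain s' u' ∧ CloseOnReal ε s s' ∧ CloseOnReal ε u u'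
  dense_noScalarFactor : 2 ≤ n → ∀ s ∈ setM n, ∀ u ∈ setG n, ∀ ε : ℝ, 0 < ε →
    ∃ s' u', InDomain s' u' ∧ NoScalarFactor s' ∧ NoScalarFactor u' ∧
      CloseOnReal ε s s' ∧ CloseOnReal ε u u'

/-- `(S, J)` is an almost group of loops, with densely defined operation `i`. -/
structure IsAlmostGroup (S J : Set (Mero n)) : Prop where
  mul_mem : ∀ g ∈ S, ∀ h ∈ S, g * h ∈ S
  i_mem : ∀ g ∈ S, Generic g → iOp g ∈ S ∧ Generic (iOp g)
  i_bij : Set.BijOn iOp {g | g ∈ S ∧ Generic g ∧ NoScalarFactor g}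
    {g | g ∈ S ∧ Generic g ∧ NoScalarFactor g}
  J_subset : J ⊆ S
  J_mul_mem : ∀ j ∈ J, ∀ k ∈ J, j * k ∈ J
  J_i_mem : ∀ j ∈ J, Generic j → iOp j ∈ J
  i_mul : ∀ g ∈ S, ∀ h ∈ S, Generic g → Generic h → Separated g h →
    iOp (g * h) = iOp h * iOp g
  J_comm : ∀ g ∈ S, ∀ j ∈ J, j * g = g * j
  mul_i : ∀ g ∈ S, Generic g → g * iOp g = iOp g * g ∧ g * iOp g ∈ J
  i_i : ∀ g ∈ S, Generic g → NoScalarFactor g → iOp (iOp g) = g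

/-- The rules of a matched pair for the loop almost groups `(G, J_G)` and `(M, J_M)`, with densely
defined actions: each rule comes with the statement that all its terms are defined. -/
structure IsMatchedPair (n : ℕ) : Prop where
  act_mem : ∀ s u : Mero n, InDomain s u →
    lact s u ∈ setG n ∧ ract s u ∈ setM n ∧ s * u = lact s u * ract s u
  act_mul : ∀ s : Mero n, ∀ u ∈ setG n, ∀ v ∈ setG n, InDomain s (u * v) →
    InDomain s u ∧ InDomain (ract s u) v ∧
      ract s (u * v) = ract (ract s u) v ∧
      lact s (u * v) = lact s u * lact (ract s u) v
  mul_act : ∀ s ∈ setM n, ∀ t ∈ setM n, ∀ u : Mero n, InDomain (s * t) u →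
    InDomain t u ∧ InDomain s (lact t u) ∧
      ract (s * t) u = ract s (lact t u) * ract t u ∧
      lact (s * t) u = lact s (lact t u)
  act_i : ∀ s u : Mero n, InDomain s u →
    InDomain (iOp (ract s u)) (iOp (lact s u)) ∧
      lact (iOp (ract s u)) (iOp (lact s u)) = iOp u ∧
      ract (iOp (ract s u)) (iOp (lact s u)) = iOp s
  JM_act : ∀ j ∈ setJM n, ∀ u : Mero n, InDomain j u → lact j u = u ∧ ract j u = j
  act_JG : ∀ s : Mero n, ∀ j ∈ setJG n, InDomain s j → lact s j = j ∧ ract s j = s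

/-- The product of the doublecross product `G ⋈ M` of pairs `(u, s)`. -/
def dcMul (p q : Mero n × Mero n) : Mero n × Mero n :=
  (p.1 * lact p.2 q.1, ract p.2 q.1 * q.2)

/-- The operation `i` of the doublecross product `G ⋈ M`. -/
def dcI (p : Mero n × Mero n) : Mero n × Mero n :=
  (lact (iOp p.2) (iOp p.1), ract (iOp p.2) (iOp p.1))

/-- The doublecross product `G ⋈ M` is the group of meromorphic loops under pointwise
multiplication, the pair `(u, s)` being identified with the loop `u s`. -/
structure DoublecrossIsLoopGroup (n : ℕ) : Prop where
  subgroup : ∃ L : Subgroup (Mero n), (L : Set (Mero n)) = loops n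
  image : (fun p : Mero n × Mero n => p.1 * p.2) '' (setG n ×ˢ setM n) = loops n
  bijOn : Set.BijOn (fun p : Mero n × Mero n => p.1 * p.2) {p | InDomain p.2 p.1}
    {x | x ∈ loops n ∧ Generic x}
  mul : ∀ u ∈ setG n, ∀ s ∈ setM n, ∀ v ∈ setG n, ∀ t ∈ setM n, InDomain s v →
    dcMul (u, s) (v, t) ∈ setG n ×ˢ setM n ∧
      (dcMul (u, s) (v, t)).1 * (dcMul (u, s) (v, t)).2 = (u * s) * (v * t)
  i : ∀ u s : Mero n, InDomain s u →
    dcI (u, s) ∈ setG n ×ˢ setM n ∧ (dcI (u, s)).1 * (dcI (u, s)).2 = iOp (u * s)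

/-- The conditions for the matched pair to be mutually inverse. -/
structure IsMutuallyInverse (n : ℕ) : Prop where
  doublecross : DoublecrossIsLoopGroup n
  inv_mem_G : ∀ s ∈ setM n, s⁻¹ ∈ setG n
  inv_mem_M : ∀ u ∈ setG n, u⁻¹ ∈ setM n
  inv_J : Set.BijOn (fun j : Mero n => j⁻¹) (setJG n) (setJM n)
  inv_i : ∀ x ∈ loops n, Generic x → Generic x⁻¹ ∧ iOp x⁻¹ = (iOp x)⁻¹
  -- the same for all loops, with all the possible values of `i`
  inv_i_all : ∀ x ∈ loops n, ∀ y : Mero n, IsIImage x y ↔ IsIImage x⁻¹ y⁻¹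
  inv_act : ∀ s u : Mero n, InDomain s u → InDomain u⁻¹ s⁻¹ ∧
    lact u⁻¹ s⁻¹ = (ract s u)⁻¹ ∧ ract u⁻¹ s⁻¹ = (lact s u)⁻¹
  -- the same for all pairs, with all the possible values of the actions
  inv_act_all : ∀ s ∈ setM n, ∀ u ∈ setG n, ∀ u' s' : Mero n,
    IsMinFactorsGM (s * u) u' s' ↔ IsMinFactorsGM (u⁻¹ * s⁻¹) s'⁻¹ u'⁻¹

end

end MeroLoop

open scoped Topology ComplexConjugate Matrix

namespace MeroLoop

noncomputable section

variable {n : ℕ}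

/-! ### Rational functions regular at a point -/

/-! Unitarity on the real line is an identity between rational functions, so a loop x satisfies x(λ)
x(conj λ)^* = 1 everywhere (`loops_mul_adj`). Hence the poles of x⁻¹ are the conjugates of the poles
of x, and by Liouville a loop without poles is 1 (`eq_one_of_no_pole`). Almost every identity is
reduced to these two facts by looking at poles only.

Existence. For u in G, a zero b of det u in the upper half plane is removed by multiplying with
Φ_{b,P}, where P projects onto a line in the kernel of u(b). This lowers the degree of the numerator
of the determinant, and once no such zero is left, u = 1. Inversion gives the same for M. A general
loop is brought into G by dividing by scalar functions θ_b from M. So every loop is a product of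
basic loops, and minimal factorisations exist.

Uniqueness for generic x. At a pole a, x⁻¹ is regular and x⁻¹(a) annihilates the residue. If P is
the orthogonal projection onto the range of the residue, Φ_{a,P}⁻¹ x has lost the pole a and gained
none (`exists_split_pole`). So x is a product of basic loops with each pole used once, in any order.
No factorisation is shorter, since every pole has to occur. Because Φ^i = θ Φ⁻¹, every i-image of x
equals (∏ θ_a over the poles a) x⁻¹ (`iOp_eq`), from which the rules for i are read off. Likewise,
the minimal factorisation x = u s into G and M is the one in which u and s have only poles of x
(`isMinFactorsGM_iff`); two such factorisations agree by Liouville (`PoleFactors.unique`). Each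
matched pair law then follows by exhibiting a factorisation with admissible poles.

Density. The poles of the basic factors are moved slightly into general position with the
projections fixed. For n ≥ 2 each scalar factor is first split as Φ_{α,Q} Φ_{α,1-Q}. -/

/-- The local ring of rational functions without a pole at `a`. -/
def regularAt (a : ℂ) : Subring (RatFunc ℂ) where
  carrier := {f | ¬ ScalarPole f a}
  zero_mem' := by simp [ScalarPole]
  one_mem' := by simp [ScalarPole]
  add_mem' {f g} hf hg h := by
    have := Polynomial.eval_eq_zero_of_dvd_of_eval_eq_zero (RatFunc.denom_add_dvd f g) h
    rw [Polynomial.eval_mul, mul_eq_zero] at this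
    exact this.elim hf hg
  mul_mem' {f g} hf hg h := by
    have := Polynomial.eval_eq_zero_of_dvd_of_eval_eq_zero (RatFunc.denom_mul_dvd f g) h
    rw [Polynomial.eval_mul, mul_eq_zero] at this
    exact this.elim hf hg
  neg_mem' {f} hf h := by
    have h1 : -f = algebraMap _ _ (-1 : Polynomial ℂ) * f := by simp
    rw [h1] at h
    have := Polynomial.eval_eq_zero_of_dvd_of_eval_eq_zero (RatFunc.denom_mul_dvd _ f) h
    rw [RatFunc.denom_algebraMap, one_mul] at this
    exact hf this

lemma mem_regularAt {f : RatFunc ℂ} {a : ℂ} : f ∈ regularAt a ↔ ¬ ScalarPole f a := Iff.rfl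

lemma div_mem_regularAt (p : Polynomial ℂ) {q : Polynomial ℂ} {a : ℂ} (hq : q.eval a ≠ 0) :
    algebraMap _ (RatFunc ℂ) p / algebraMap _ (RatFunc ℂ) q ∈ regularAt a := fun h =>
  hq (Polynomial.eval_eq_zero_of_dvd_of_eval_eq_zero (RatFunc.denom_div_dvd p q) h)

lemma algebraMap_mem_regularAt (p : Polynomial ℂ) (a : ℂ) :
    algebraMap _ (RatFunc ℂ) p ∈ regularAt a := by
  simpa using div_mem_regularAt p (q := 1) (a := a) (by simp)

lemma C_mem_regularAt (c a : ℂ) : RatFunc.C c ∈ regularAt a := by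
  simp [mem_regularAt, ScalarPole]

lemma X_mem_regularAt (a : ℂ) : (RatFunc.X : RatFunc ℂ) ∈ regularAt a := by
  simp [mem_regularAt, ScalarPole]

/-- The value of a rational function at `a`. -/
abbrev ev (a : ℂ) (f : RatFunc ℂ) : ℂ := RatFunc.eval (RingHom.id ℂ) a f

lemma ev_add {f g : RatFunc ℂ} {a : ℂ} (hf : f ∈ regularAt a) (hg : g ∈ regularAt a) :
    ev a (f + g) = ev a f + ev a g := RatFunc.eval_add _ _ hf hg

lemma ev_mul {f g : RatFunc ℂ} {a : ℂ} (hf : f ∈ regularAt a) (hg : g ∈ regularAt a) :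
    ev a (f * g) = ev a f * ev a g := RatFunc.eval_mul _ _ hf hg

/-- Evaluation at `a` as a ring homomorphism on the local ring. -/
def evHom (a : ℂ) : regularAt a →+* ℂ where
  toFun f := ev a f
  map_one' := by simp
  map_zero' := by simp
  map_mul' f g := ev_mul f.2 g.2
  map_add' f g := ev_add f.2 g.2

lemma ev_sub {f g : RatFunc ℂ} {a : ℂ} (hf : f ∈ regularAt a) (hg : g ∈ regularAt a) :
    ev a (f - g) = ev a f - ev a g := map_sub (evHom a) ⟨f, hf⟩ ⟨g, hg⟩

lemma ev_algebraMap (p : Polynomial ℂ) (a : ℂ) :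
    ev a (algebraMap _ (RatFunc ℂ) p) = p.eval a := by
  simp [ev, RatFunc.eval, Polynomial.eval₂_id]

lemma X_sub_C_eq (a : ℂ) : (RatFunc.X - RatFunc.C a : RatFunc ℂ) =
    algebraMap _ (RatFunc ℂ) (Polynomial.X - Polynomial.C a) := by simp

lemma X_sub_C_ne_zero (a : ℂ) : (RatFunc.X - RatFunc.C a : RatFunc ℂ) ≠ 0 := by
  rw [X_sub_C_eq, Ne, FaithfulSMul.algebraMap_eq_zero_iff]
  exact Polynomial.X_sub_C_ne_zero a

lemma X_sub_C_mem_regularAt (a b : ℂ) : (RatFunc.X - RatFunc.C a : RatFunc ℂ) ∈ regularAt b :=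
  sub_mem (X_mem_regularAt b) (C_mem_regularAt a b)

lemma ev_X_sub_C (a b : ℂ) : ev b (RatFunc.X - RatFunc.C a) = b - a := by
  rw [X_sub_C_eq, ev_algebraMap]; simp

/-- Regularity of `f` need not be assumed: `RatFunc.eval` divides by zero with result 0, so a
nonzero value already excludes a zero of the numerator, and the denominator of `f⁻¹` divides that
numerator. -/
lemma inv_mem_regularAt {f : RatFunc ℂ} {a : ℂ} (h : ev a f ≠ 0) : f⁻¹ ∈ regularAt a := by
  have h0 : f ≠ 0 := by rintro rfl; simp at h
  intro h'
  refine h ?_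
  have := Polynomial.eval_eq_zero_of_dvd_of_eval_eq_zero (RatFunc.denom_inv_dvd h0) h'
  simp [ev, RatFunc.eval, Polynomial.eval₂_id, this]

lemma ev_inv {f : RatFunc ℂ} {a : ℂ} (hf : f ∈ regularAt a) (h : ev a f ≠ 0) :
    ev a f⁻¹ = (ev a f)⁻¹ := by
  have h0 : f ≠ 0 := by rintro rfl; simp at h
  refine eq_inv_of_mul_eq_one_left ?_
  rw [← ev_mul (inv_mem_regularAt h) hf, inv_mul_cancel₀ h0]
  simp

lemma inv_X_sub_C_mul_mem_regularAt {f : RatFunc ℂ} {a : ℂ} (hf : f ∈ regularAt a)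
    (h : ev a f = 0) : (RatFunc.X - RatFunc.C a)⁻¹ * f ∈ regularAt a := by
  have h1 : f.num.eval a = 0 := by
    have : f.num.eval a / f.denom.eval a = 0 := by
      simpa only [ev, RatFunc.eval, Polynomial.eval₂_id] using h
    exact (div_eq_zero_iff.1 this).resolve_right hf
  obtain ⟨q, hq⟩ := Polynomial.dvd_iff_isRoot.2 h1
  have : (RatFunc.X - RatFunc.C a)⁻¹ * f =
      algebraMap _ (RatFunc ℂ) q / algebraMap _ (RatFunc ℂ) f.denom := by
    conv_lhs => rw [← RatFunc.num_div_denom f, hq, map_mul, ← X_sub_C_eq]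
    field_simp [X_sub_C_ne_zero a]
  rw [this]
  exact div_mem_regularAt q hf

lemma finite_scalarPole (f : RatFunc ℂ) : {a | ScalarPole f a}.Finite := by
  refine (f.denom.roots.toFinset.finite_toSet).subset fun a ha => ?_
  simpa [RatFunc.denom_ne_zero, ScalarPole] using ha

/-- A rational function which vanishes at all real numbers is zero. -/
lemma eq_zero_of_real {f : RatFunc ℂ} (hr : ∀ t : ℝ, f ∈ regularAt (t : ℂ))
    (h : ∀ t : ℝ, ev (t : ℂ) f = 0) : f = 0 := by
  have h1 : f.num = 0 := by
    refine Polynomial.eq_zero_of_infinite_isRoot _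
      ((Set.infinite_range_of_injective Complex.ofReal_injective).mono ?_)
    rintro _ ⟨t, rfl⟩
    have := h t
    simp only [ev, RatFunc.eval, Polynomial.eval₂_id] at this
    exact (div_eq_zero_iff.1 this).resolve_right (hr t)
  exact RatFunc.num_eq_zero_iff.1 h1

/-- Liouville's theorem for rational functions. -/
lemma eq_C_of_regular {f : RatFunc ℂ} {c : ℂ} (hr : ∀ a, f ∈ regularAt a)
    (h : Filter.Tendsto (fun a => ev a f) (Filter.cocompact ℂ) (𝓝 c)) : f = RatFunc.C c := by
  have h1 : f.denom = 1 := by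
    refine (RatFunc.monic_denom f).natDegree_eq_zero.1 ?_
    by_contra h0
    obtain ⟨a, ha⟩ := IsAlgClosed.exists_root f.denom
      (fun h => h0 (Polynomial.natDegree_eq_of_degree_eq_some h))
    exact hr a ha
  have h2 : f = algebraMap _ _ f.num := by
    conv_lhs => rw [← RatFunc.num_div_denom f, h1]
    simp
  have h3 : ∀ a, ev a f = f.num.eval a := fun a => by
    conv_lhs => rw [h2]
    exact ev_algebraMap _ _
  have h4 : f.num = Polynomial.C c := by
    refine Polynomial.funext fun a => ?_
    simp only [h3] at h
    rw [f.num.differentiable.apply_eq_of_tendsto_cocompact a h, Polynomial.eval_C]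
  rw [h2, h4, RatFunc.algebraMap_C]

/-! ### Complex conjugation -/

/-- `f ↦ conj (f (conj λ))`. -/
def conjR : RatFunc ℂ →+* RatFunc ℂ :=
  RatFunc.mapRingHom (Polynomial.mapRingHom (starRingEnd ℂ))
    (nonZeroDivisors_le_comap_nonZeroDivisors_of_injective _
      (Polynomial.map_injective _ (starRingEnd ℂ).injective))

lemma conjR_div (p q : Polynomial ℂ) :
    conjR (algebraMap _ (RatFunc ℂ) p / algebraMap _ (RatFunc ℂ) q) =
      algebraMap _ (RatFunc ℂ) (p.map (starRingEnd ℂ)) /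
        algebraMap _ (RatFunc ℂ) (q.map (starRingEnd ℂ)) := by
  rw [conjR, RatFunc.coe_mapRingHom_eq_coe_map, RatFunc.map_apply_div]
  rfl

lemma eval_map_conj (p : Polynomial ℂ) (a : ℂ) :
    (p.map (starRingEnd ℂ)).eval a = conj (p.eval (conj a)) := by
  conv_lhs => rw [← Complex.conj_conj a]
  rw [Polynomial.eval_map, Polynomial.eval₂_at_apply]

lemma conjR_algebraMap (p : Polynomial ℂ) : conjR (algebraMap _ (RatFunc ℂ) p) =
    algebraMap _ (RatFunc ℂ) (p.map (starRingEnd ℂ)) := by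
  simpa using conjR_div p 1

lemma conjR_conjR (f : RatFunc ℂ) : conjR (conjR f) = f := by
  conv_lhs => rw [← RatFunc.num_div_denom f, conjR_div, conjR_div]
  have h : (starRingEnd ℂ).comp (starRingEnd ℂ) = RingHom.id ℂ := by ext; simp
  simp only [Polynomial.map_map, h, Polynomial.map_id]
  exact RatFunc.num_div_denom f

lemma conjR_mem_regularAt {f : RatFunc ℂ} {a : ℂ} (h : f ∈ regularAt (conj a)) :
    conjR f ∈ regularAt a := by
  rw [← RatFunc.num_div_denom f, conjR_div]
  refine div_mem_regularAt _ ?_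
  rw [eval_map_conj]
  exact (map_ne_zero _).2 h

lemma conjR_mem_regularAt_iff {f : RatFunc ℂ} {a : ℂ} :
    conjR f ∈ regularAt a ↔ f ∈ regularAt (conj a) := by
  refine ⟨fun h => ?_, conjR_mem_regularAt⟩
  rw [← conjR_conjR f]
  exact conjR_mem_regularAt (by rwa [Complex.conj_conj])

lemma ev_div {p q : Polynomial ℂ} {a : ℂ} (h : q.eval a ≠ 0) :
    ev a (algebraMap _ (RatFunc ℂ) p / algebraMap _ (RatFunc ℂ) q) = p.eval a / q.eval a := by
  have h' : ev a (algebraMap _ (RatFunc ℂ) q) ≠ 0 := by rwa [ev_algebraMap]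
  rw [div_eq_mul_inv, ev_mul (algebraMap_mem_regularAt _ _) (inv_mem_regularAt h'),
    ev_inv (algebraMap_mem_regularAt _ _) h', ev_algebraMap, ev_algebraMap, div_eq_mul_inv]

lemma ev_conjR {f : RatFunc ℂ} {a : ℂ} (h : f ∈ regularAt (conj a)) :
    ev a (conjR f) = conj (ev (conj a) f) := by
  have h' : (f.denom.map (starRingEnd ℂ)).eval a ≠ 0 := by
    rw [eval_map_conj]; exact (map_ne_zero _).2 h
  conv_lhs => rw [← RatFunc.num_div_denom f, conjR_div, ev_div h']
  rw [eval_map_conj, eval_map_conj, ← map_div₀]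
  simp only [ev, RatFunc.eval, Polynomial.eval₂_id]

lemma conjR_C (c : ℂ) : conjR (RatFunc.C c) = RatFunc.C (conj c) := by
  rw [← RatFunc.algebraMap_C, conjR_algebraMap, Polynomial.map_C, RatFunc.algebraMap_C]

lemma conjR_X : conjR RatFunc.X = RatFunc.X := by
  rw [← RatFunc.algebraMap_X, conjR_algebraMap, Polynomial.map_X]

/-! ### Matrices of rational functions regular at a point -/

/-- Matrices of rational functions. -/
abbrev RMat (n : ℕ) : Type := Matrix (Fin n) (Fin n) (RatFunc ℂ)

/-- Matrices without a pole at `a`. -/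
abbrev mregularAt (n : ℕ) (a : ℂ) : Subring (RMat n) := (regularAt a).matrix

/-- Entrywise evaluation. -/
def evM (a : ℂ) (A : RMat n) : Matrix (Fin n) (Fin n) ℂ := A.map (ev a)

/-- Evaluation is a ring homomorphism only on the local ring. Lifting a regular matrix there lets
products, determinants and adjugates be treated by functoriality. -/
lemma exists_lift {a : ℂ} {A : RMat n} (h : A ∈ mregularAt n a) :
    ∃ B : Matrix (Fin n) (Fin n) (regularAt a), A = B.map (regularAt a).subtype ∧
      evM a A = B.map (evHom a) :=
  ⟨fun k l => ⟨A k l, h k l⟩, rfl, rfl⟩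

lemma map_subtype_mem {a : ℂ} (B : Matrix (Fin n) (Fin n) (regularAt a)) :
    B.map (regularAt a).subtype ∈ mregularAt n a := fun k l => (B k l).2

lemma evM_map_subtype {a : ℂ} (B : Matrix (Fin n) (Fin n) (regularAt a)) :
    evM a (B.map (regularAt a).subtype) = B.map (evHom a) := rfl

lemma evM_mul {a : ℂ} {A B : RMat n} (hA : A ∈ mregularAt n a) (hB : B ∈ mregularAt n a) :
    evM a (A * B) = evM a A * evM a B := by
  obtain ⟨A, rfl, hA'⟩ := exists_lift hA
  obtain ⟨B, rfl, hB'⟩ := exists_lift hB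
  rw [hA', hB', ← Matrix.map_mul, ← Matrix.map_mul, evM_map_subtype]

lemma evM_add {a : ℂ} {A B : RMat n} (hA : A ∈ mregularAt n a) (hB : B ∈ mregularAt n a) :
    evM a (A + B) = evM a A + evM a B := by
  ext k l
  exact ev_add (hA k l) (hB k l)

lemma evM_one (a : ℂ) : evM a (1 : RMat n) = 1 := by
  ext k l
  by_cases h : k = l <;> simp [evM, Matrix.one_apply, h]

lemma smul_mem_mregularAt {a : ℂ} {f : RatFunc ℂ} {A : RMat n} (hf : f ∈ regularAt a)
    (hA : A ∈ mregularAt n a) : f • A ∈ mregularAt n a := fun k l => (regularAt a).mul_mem hf (hA k l)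

lemma evM_smul {a : ℂ} {f : RatFunc ℂ} {A : RMat n} (hf : f ∈ regularAt a)
    (hA : A ∈ mregularAt n a) : evM a (f • A) = ev a f • evM a A := by
  ext k l
  exact ev_mul hf (hA k l)

lemma map_C_mem_mregularAt (a : ℂ) (P : Matrix (Fin n) (Fin n) ℂ) :
    P.map RatFunc.C ∈ mregularAt n a := fun _ _ => C_mem_regularAt _ a

lemma evM_map_C (a : ℂ) (P : Matrix (Fin n) (Fin n) ℂ) : evM a (P.map RatFunc.C) = P := by
  ext k l
  simp [evM]

lemma det_mem_regularAt {a : ℂ} {A : RMat n} (hA : A ∈ mregularAt n a) :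
    A.det ∈ regularAt a := by
  obtain ⟨A, rfl, -⟩ := exists_lift hA
  rw [← RingHom.mapMatrix_apply, ← RingHom.map_det]
  exact A.det.2

lemma ev_det {a : ℂ} {A : RMat n} (hA : A ∈ mregularAt n a) : ev a A.det = (evM a A).det := by
  obtain ⟨A, rfl, h⟩ := exists_lift hA
  rw [h, ← RingHom.mapMatrix_apply, ← RingHom.map_det, ← RingHom.mapMatrix_apply,
    ← RingHom.map_det]
  rfl

lemma adjugate_mem_mregularAt {a : ℂ} {A : RMat n} (hA : A ∈ mregularAt n a) :
    A.adjugate ∈ mregularAt n a := by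
  obtain ⟨A, rfl, -⟩ := exists_lift hA
  rw [← RingHom.mapMatrix_apply, ← RingHom.map_adjugate]
  exact map_subtype_mem _

lemma inv_X_sub_C_smul_mem_mregularAt {a : ℂ} {A : RMat n} (hA : A ∈ mregularAt n a)
    (h : evM a A = 0) : (RatFunc.X - RatFunc.C a)⁻¹ • A ∈ mregularAt n a := fun k l =>
  inv_X_sub_C_mul_mem_regularAt (hA k l) (congrFun (congrFun h k) l)

/-- The adjoint `A(conj λ)^*`. -/
def adj (A : RMat n) : RMat n := (A.map conjR)ᵀ

lemma adj_mul (A B : RMat n) : adj (A * B) = adj B * adj A := by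
  rw [adj, adj, adj, ← Matrix.transpose_mul, Matrix.map_mul]

lemma adj_adj (A : RMat n) : adj (adj A) = A := by
  ext k l
  exact conjR_conjR _

lemma adj_smul (f : RatFunc ℂ) (A : RMat n) : adj (f • A) = conjR f • adj A := by
  ext k l
  simp [adj]

lemma adj_add (A B : RMat n) : adj (A + B) = adj A + adj B := by
  ext k l
  simp [adj]

lemma adj_map_C (P : Matrix (Fin n) (Fin n) ℂ) : adj (P.map RatFunc.C) = Pᴴ.map RatFunc.C := by
  ext k l
  simp [adj, conjR_C]

lemma adj_mem_mregularAt_iff {a : ℂ} {A : RMat n} :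
    adj A ∈ mregularAt n a ↔ A ∈ mregularAt n (conj a) :=
  ⟨fun h k l => conjR_mem_regularAt_iff.1 (h l k), fun h k l => conjR_mem_regularAt_iff.2 (h l k)⟩

lemma evM_adj {a : ℂ} {A : RMat n} (h : A ∈ mregularAt n (conj a)) :
    evM a (adj A) = (evM (conj a) A)ᴴ := by
  ext k l
  exact ev_conjR (h l k)

/-! ### The group of loops -/

lemma not_hasPole_iff {φ : Mero n} {a : ℂ} : ¬ HasPole φ a ↔ φ.val ∈ mregularAt n a := by
  simp only [HasPole, not_exists]
  rfl

lemma hasPole_iff {φ : Mero n} {a : ℂ} : HasPole φ a ↔ φ.val ∉ mregularAt n a := by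
  rw [← not_hasPole_iff, not_not]

lemma simplePole_iff {φ : Mero n} {a : ℂ} :
    SimplePole φ a ↔ (RatFunc.X - RatFunc.C a) • φ.val ∈ mregularAt n a := Iff.rfl

lemma valueAt_eq (φ : Mero n) (a : ℂ) : valueAt φ a = evM a φ.val := rfl

lemma residue_eq (φ : Mero n) (a : ℂ) :
    residue φ a = evM a ((RatFunc.X - RatFunc.C a) • φ.val) := rfl

lemma finite_hasPole (φ : Mero n) : {a | HasPole φ a}.Finite := by
  have : {a | HasPole φ a} = ⋃ k, ⋃ l, {a | ScalarPole (φ.val k l) a} := by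
    ext a
    simp [HasPole]
  rw [this]
  exact Set.finite_iUnion fun k => Set.finite_iUnion fun l => finite_scalarPole _

lemma eventually_regular (φ : Mero n) : ∀ᶠ a in Filter.cocompact ℂ, φ.val ∈ mregularAt n a := by
  filter_upwards [(finite_hasPole φ).isCompact.compl_mem_cocompact] with a ha
  exact not_hasPole_iff.1 ha

lemma loops_regular_real {φ : Mero n} (h : φ ∈ loops n) (t : ℝ) :
    φ.val ∈ mregularAt n (t : ℂ) := not_hasPole_iff.1 (h.1 t).1

/-- At real points the adjoint is the pointwise conjugate transpose, so unitarity makes the entries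
of φ φ^* - 1 vanish on the whole real line, hence identically. -/
lemma loops_mul_adj {φ : Mero n} (h : φ ∈ loops n) : φ.val * adj φ.val = 1 := by
  have hr (t : ℝ) := loops_regular_real h t
  have ha (t : ℝ) : adj φ.val ∈ mregularAt n (t : ℂ) :=
    adj_mem_mregularAt_iff.2 (by simpa using hr t)
  ext k l
  refine sub_eq_zero.1 (eq_zero_of_real (fun t => ?_) fun t => ?_)
  · exact sub_mem (mul_mem (hr t) (ha t) k l) (one_mem (mregularAt n _) k l)
  · rw [ev_sub (mul_mem (hr t) (ha t) k l) (one_mem (mregularAt n _) k l), sub_eq_zero]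
    have h1 : evM (t : ℂ) (φ.val * adj φ.val) = evM (t : ℂ) 1 := by
      rw [evM_mul (hr t) (ha t), evM_adj (by simpa using hr t), Complex.conj_ofReal, evM_one]
      exact Matrix.mem_unitaryGroup_iff.1 (h.1 t).2
    exact congrFun (congrFun h1 k) l

lemma loops_inv_val {φ : Mero n} (h : φ ∈ loops n) : (φ⁻¹).val = adj φ.val := by
  have := congrArg (fun A => (φ⁻¹).val * A) (loops_mul_adj h)
  simpa [← mul_assoc, ← Units.val_mul] using this.symm

lemma mem_loops_of {φ : Mero n} (h : φ.val * adj φ.val = 1)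
    (hr : ∀ t : ℝ, φ.val ∈ mregularAt n (t : ℂ))
    (ht : Filter.Tendsto (valueAt φ) (Filter.cocompact ℂ) (𝓝 1)) : φ ∈ loops n := by
  refine ⟨fun t => ⟨not_hasPole_iff.2 (hr t), Matrix.mem_unitaryGroup_iff.2 ?_⟩, ht⟩
  have hc : φ.val ∈ mregularAt n (conj (t : ℂ)) := by simpa using hr t
  have := congrArg (evM (t : ℂ)) h
  rw [evM_mul (hr t) (adj_mem_mregularAt_iff.2 hc), evM_adj hc, Complex.conj_ofReal,
    evM_one] at this
  exact this

lemma mul_mem_loops {φ ψ : Mero n} (h : φ ∈ loops n) (h' : ψ ∈ loops n) : φ * ψ ∈ loops n := by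
  refine mem_loops_of ?_
    (fun t => mul_mem (loops_regular_real h t) (loops_regular_real h' t)) ?_
  · rw [Units.val_mul, adj_mul, mul_assoc, ← mul_assoc ψ.val, loops_mul_adj h', one_mul,
      loops_mul_adj h]
  · have := h.2.mul h'.2
    rw [mul_one] at this
    refine this.congr' ?_
    filter_upwards [eventually_regular φ, eventually_regular ψ] with a h1 h2
    exact (evM_mul h1 h2).symm

lemma one_mem_loops : (1 : Mero n) ∈ loops n := by
  refine mem_loops_of ?_ (fun t => one_mem _) ?_
  · have : adj (1 : RMat n) = 1 := by simp [adj, Matrix.map_one]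
    rw [Units.val_one, this, mul_one]
  · have : valueAt (1 : Mero n) = fun _ => 1 := funext fun a => evM_one a
    rw [this]
    exact tendsto_const_nhds

lemma tendsto_conj_cocompact :
    Filter.Tendsto (fun a : ℂ => conj a) (Filter.cocompact ℂ) (Filter.cocompact ℂ) :=
  Complex.conjCLE.toHomeomorph.isClosedEmbedding.tendsto_cocompact

lemma inv_mem_loops {φ : Mero n} (h : φ ∈ loops n) : φ⁻¹ ∈ loops n := by
  refine mem_loops_of ?_ (fun t => ?_) ?_
  · rw [loops_inv_val h, adj_adj, ← loops_inv_val h, ← Units.val_mul, inv_mul_cancel,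
      Units.val_one]
  · rw [loops_inv_val h, adj_mem_mregularAt_iff, Complex.conj_ofReal]
    exact loops_regular_real h t
  · have h1 : Filter.Tendsto (fun a => (valueAt φ (conj a))ᴴ) (Filter.cocompact ℂ) (𝓝 1) := by
      have := ((continuous_id.matrix_conjTranspose).tendsto
        (1 : Matrix (Fin n) (Fin n) ℂ)).comp (h.2.comp tendsto_conj_cocompact)
      simpa [Function.comp_def] using this
    refine h1.congr' ?_
    filter_upwards [tendsto_conj_cocompact.eventually (eventually_regular φ)] with a ha
    rw [valueAt_eq, valueAt_eq, loops_inv_val h, evM_adj ha]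

/-- The group of loops. -/
def loopGroup (n : ℕ) : Subgroup (Mero n) where
  carrier := loops n
  mul_mem' := mul_mem_loops
  one_mem' := one_mem_loops
  inv_mem' := inv_mem_loops

/-- Liouville in each entry, the constant being the value at infinity. All uniqueness statements
rest on this. -/
lemma eq_one_of_no_pole {φ : Mero n} (h : φ ∈ loops n) (hp : ∀ a, ¬ HasPole φ a) : φ = 1 := by
  refine Units.ext ?_
  ext k l
  have h1 : φ.val k l = RatFunc.C ((1 : Matrix (Fin n) (Fin n) ℂ) k l) := by
    refine eq_C_of_regular (fun a => not_hasPole_iff.1 (hp a) k l) ?_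
    exact ((continuous_apply_apply k l).tendsto _).comp h.2
  rw [h1, Units.val_one]
  by_cases hkl : k = l <;> simp [Matrix.one_apply, hkl]

lemma hasPole_inv {φ : Mero n} (h : φ ∈ loops n) {a : ℂ} :
    HasPole φ⁻¹ a ↔ HasPole φ (conj a) := by
  rw [hasPole_iff, hasPole_iff, loops_inv_val h, adj_mem_mregularAt_iff]

lemma simplePole_inv {φ : Mero n} (h : φ ∈ loops n) {a : ℂ} :
    SimplePole φ⁻¹ a ↔ SimplePole φ (conj a) := by
  rw [simplePole_iff, simplePole_iff, loops_inv_val h, ← adj_mem_mregularAt_iff, adj_smul]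
  simp [conjR_X, conjR_C]

lemma not_hasPole_mul {φ ψ : Mero n} {a : ℂ} (h : ¬ HasPole φ a) (h' : ¬ HasPole ψ a) :
    ¬ HasPole (φ * ψ) a := by
  rw [not_hasPole_iff] at *
  exact mul_mem h h'

lemma hasPole_of_mul {φ ψ : Mero n} {a : ℂ} (h : HasPole (φ * ψ) a) :
    HasPole φ a ∨ HasPole ψ a := by
  by_contra h'
  push Not at h'
  exact not_hasPole_mul h'.1 h'.2 h

lemma simplePole_mul_left {φ ψ : Mero n} {a : ℂ} (h : SimplePole φ a) (h' : ¬ HasPole ψ a) :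
    SimplePole (φ * ψ) a := by
  rw [simplePole_iff, Units.val_mul, ← smul_mul_assoc]
  exact mul_mem h (not_hasPole_iff.1 h')

lemma simplePole_mul_right {φ ψ : Mero n} {a : ℂ} (h : ¬ HasPole φ a) (h' : SimplePole ψ a) :
    SimplePole (φ * ψ) a := by
  rw [simplePole_iff, Units.val_mul, ← mul_smul_comm]
  exact mul_mem (not_hasPole_iff.1 h) h'

lemma residue_mul_left {φ ψ : Mero n} {a : ℂ} (h : SimplePole φ a) (h' : ¬ HasPole ψ a) :
    residue (φ * ψ) a = residue φ a * valueAt ψ a := by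
  rw [residue_eq, Units.val_mul, ← smul_mul_assoc, evM_mul (simplePole_iff.1 h) (not_hasPole_iff.1 h')]
  rfl

lemma residue_mul_right {φ ψ : Mero n} {a : ℂ} (h : ¬ HasPole φ a) (h' : SimplePole ψ a) :
    residue (φ * ψ) a = valueAt φ a * residue ψ a := by
  rw [residue_eq, Units.val_mul, ← mul_smul_comm, evM_mul (not_hasPole_iff.1 h) (simplePole_iff.1 h')]
  rfl

/-- The finite set of poles. -/
def poles (φ : Mero n) : Finset ℂ := (finite_hasPole φ).toFinset

lemma mem_poles {φ : Mero n} {a : ℂ} : a ∈ poles φ ↔ HasPole φ a := by simp [poles]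

lemma im_ne_zero_of_hasPole {φ : Mero n} (h : φ ∈ loops n) {a : ℂ} (ha : HasPole φ a) :
    a.im ≠ 0 := by
  intro h0
  have h1 : ((a.re : ℝ) : ℂ) = a := Complex.ext (by simp) (by simp [h0])
  exact (h.1 a.re).1 (h1 ▸ ha)

/-! ### Scalar loops and basic loops -/

lemma conj_ne_self {α : ℂ} (h : α.im ≠ 0) : conj α ≠ α := fun h' => h (Complex.conj_eq_iff_im.1 h')

lemma theta_ne_zero (α : ℂ) : theta α ≠ 0 :=
  div_ne_zero (X_sub_C_ne_zero _) (X_sub_C_ne_zero _)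

lemma theta_conj (α : ℂ) : theta (conj α) = (theta α)⁻¹ := by
  rw [theta, theta, inv_div, Complex.conj_conj]

lemma conjR_theta (α : ℂ) : conjR (theta α) = theta (conj α) := by
  simp [theta, conjR_X, conjR_C]

lemma theta_mem_regularAt {α a : ℂ} (h : a ≠ α) : theta α ∈ regularAt a := by
  rw [theta, div_eq_mul_inv]
  refine mul_mem (X_sub_C_mem_regularAt _ _) (inv_mem_regularAt ?_)
  rw [ev_X_sub_C]
  exact sub_ne_zero.2 h

lemma ev_theta {α a : ℂ} (h : a ≠ α) : ev a (theta α) = (a - conj α) / (a - α) := by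
  have h' : ev a (RatFunc.X - RatFunc.C α) ≠ 0 := by rw [ev_X_sub_C]; exact sub_ne_zero.2 h
  rw [theta, div_eq_mul_inv, ev_mul (X_sub_C_mem_regularAt _ _) (inv_mem_regularAt h'),
    ev_inv (X_sub_C_mem_regularAt _ _) h', ev_X_sub_C, ev_X_sub_C, div_eq_mul_inv]

lemma X_sub_C_mul_theta (α : ℂ) :
    (RatFunc.X - RatFunc.C α) * theta α = RatFunc.X - RatFunc.C (conj α) :=
  mul_div_cancel₀ _ (X_sub_C_ne_zero α)

lemma tendsto_ev_theta (α : ℂ) :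
    Filter.Tendsto (fun a => ev a (theta α)) (Filter.cocompact ℂ) (𝓝 1) := by
  have h1 : Filter.Tendsto (fun a : ℂ => 1 + (α - conj α) * (a - α)⁻¹) (Filter.cocompact ℂ)
      (𝓝 (1 + (α - conj α) * 0)) := by
    refine tendsto_const_nhds.add (tendsto_const_nhds.mul ?_)
    refine (Filter.tendsto_inv₀_cobounded (α := ℂ)).comp ?_
    rw [Metric.cobounded_eq_cocompact]
    exact (Homeomorph.subRight α).isClosedEmbedding.tendsto_cocompact
  rw [mul_zero, add_zero] at h1
  refine h1.congr' ?_
  filter_upwards [(Set.finite_singleton α).isCompact.compl_mem_cocompact] with a ha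
  have : a - α ≠ 0 := sub_ne_zero.2 ha
  rw [ev_theta ha]
  field_simp
  ring

/-- `θ_α` as a unit. -/
def thetaU (α : ℂ) : (RatFunc ℂ)ˣ := Units.mk0 (theta α) (theta_ne_zero α)

lemma thetaU_conj (α : ℂ) : thetaU (conj α) = (thetaU α)⁻¹ := by
  ext
  simp [thetaU, theta_conj]

/-- Scalar matrices. -/
def scal (n : ℕ) : (RatFunc ℂ)ˣ →* Mero n :=
  Units.map (Matrix.scalar (Fin n) : RatFunc ℂ →+* RMat n).toMonoidHom

lemma scal_val (f : (RatFunc ℂ)ˣ) : (scal n f).val = (f : RatFunc ℂ) • (1 : RMat n) := by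
  rw [Matrix.smul_one_eq_diagonal]
  rfl

lemma scal_mul_val (f : (RatFunc ℂ)ˣ) (φ : Mero n) :
    (scal n f * φ).val = (f : RatFunc ℂ) • φ.val := by
  rw [Units.val_mul, scal_val, smul_mul_assoc, one_mul]

lemma isScalar_mul_comm {φ : Mero n} (h : IsScalar φ) (ψ : Mero n) : φ * ψ = ψ * φ := by
  obtain ⟨f, hf⟩ := h
  refine Units.ext ?_
  rw [Units.val_mul, Units.val_mul, hf]
  exact Matrix.scalar_commute f (fun _ => Commute.all _ _) ψ.val

lemma isScalar_scal (f : (RatFunc ℂ)ˣ) : IsScalar (scal n f) := ⟨f, rfl⟩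

lemma scal_mul_comm (f : (RatFunc ℂ)ˣ) (φ : Mero n) : scal n f * φ = φ * scal n f :=
  isScalar_mul_comm (isScalar_scal f) φ

lemma IsScalar.mul {φ ψ : Mero n} (h : IsScalar φ) (h' : IsScalar ψ) : IsScalar (φ * ψ) := by
  obtain ⟨f, hf⟩ := h
  obtain ⟨g, hg⟩ := h'
  exact ⟨f * g, by rw [Units.val_mul, hf, hg, map_mul]⟩

lemma IsScalar.inv {φ : Mero n} (h : IsScalar φ) : IsScalar φ⁻¹ := by
  obtain ⟨f, hf⟩ := h
  -- For n = 0 the function `f` is not determined and may be zero, so it cannot be inverted; every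
  -- matrix is then scalar anyway.
  rcases isEmpty_or_nonempty (Fin n) with hn | ⟨⟨k⟩⟩
  · exact ⟨0, Subsingleton.elim _ _⟩
  · have h0 : f ≠ 0 := by
      rintro rfl
      have h1 : (φ⁻¹).val * φ.val = 1 := by rw [← Units.val_mul, inv_mul_cancel, Units.val_one]
      rw [hf, map_zero, mul_zero] at h1
      simpa using congrFun (congrFun h1 k) k
    have : φ = scal n (Units.mk0 f h0) := Units.ext hf
    rw [this, ← map_inv]
    exact isScalar_scal _

/-- The parameters of the inverse of a basic loop. -/
def conjPair (p : ℂ × Matrix (Fin n) (Fin n) ℂ) : ℂ × Matrix (Fin n) (Fin n) ℂ := (conj p.1, p.2)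

lemma ValidPair.conjPair {p : ℂ × Matrix (Fin n) (Fin n) ℂ} (h : ValidPair p) :
    ValidPair (conjPair p) := ⟨by simpa [MeroLoop.conjPair] using h.1, h.2⟩

lemma conjPair_conjPair (p : ℂ × Matrix (Fin n) (Fin n) ℂ) : conjPair (conjPair p) = p := by
  simp [conjPair]

lemma basicLoop_mul_basicLoop_conjPair {p : ℂ × Matrix (Fin n) (Fin n) ℂ} (h : ValidPair p) :
    basicLoop p * basicLoop (conjPair p) = 1 := by
  have h1 : ((1 - p.2) * (1 - p.2)) = 1 - p.2 := by
    rw [mul_sub, sub_mul, sub_mul, h.2.2]; simp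
  have h2 : (1 - p.2) * p.2 = 0 := by rw [sub_mul, h.2.2]; simp
  have h3 : p.2 * (1 - p.2) = 0 := by rw [mul_sub, h.2.2]; simp
  simp only [basicLoop, conjPair, theta_conj, add_mul, mul_add, smul_mul_assoc, mul_smul_comm,
    ← Matrix.map_mul, h1, h2, h3, h.2.2]
  ext k l
  by_cases hkl : k = l <;> simp [hkl, Matrix.one_apply, theta_ne_zero p.1]

/-- A basic loop as an invertible matrix. -/
def basicGL (p : ℂ × Matrix (Fin n) (Fin n) ℂ) (h : ValidPair p) : Mero n where
  val := basicLoop p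
  inv := basicLoop (conjPair p)
  val_inv := basicLoop_mul_basicLoop_conjPair h
  inv_val := by
    simpa only [conjPair_conjPair] using basicLoop_mul_basicLoop_conjPair h.conjPair

lemma basicGL_val {p : ℂ × Matrix (Fin n) (Fin n) ℂ} (h : ValidPair p) :
    (basicGL p h).val = basicLoop p := rfl

lemma basicGL_inv {p : ℂ × Matrix (Fin n) (Fin n) ℂ} (h : ValidPair p) :
    (basicGL p h)⁻¹ = basicGL (conjPair p) h.conjPair := by
  refine inv_eq_of_mul_eq_one_right (Units.ext ?_)
  exact basicLoop_mul_basicLoop_conjPair h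

lemma adj_basicLoop {p : ℂ × Matrix (Fin n) (Fin n) ℂ} (h : ValidPair p) :
    adj (basicLoop p) = basicLoop (conjPair p) := by
  rw [basicLoop, adj_add, adj_smul, adj_map_C, adj_map_C, conjR_theta, Matrix.conjTranspose_sub,
    h.2.1.eq, Matrix.conjTranspose_one]
  rfl

lemma basicLoop_mem_mregularAt (p : ℂ × Matrix (Fin n) (Fin n) ℂ) {a : ℂ} (h : a ≠ p.1) :
    basicLoop p ∈ mregularAt n a :=
  add_mem (map_C_mem_mregularAt _ _)
    (smul_mem_mregularAt (theta_mem_regularAt h) (map_C_mem_mregularAt _ _))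

lemma evM_basicLoop (p : ℂ × Matrix (Fin n) (Fin n) ℂ) {a : ℂ} (h : a ≠ p.1) :
    evM a (basicLoop p) = (1 - p.2) + ev a (theta p.1) • p.2 := by
  rw [basicLoop, evM_add (map_C_mem_mregularAt _ _)
    (smul_mem_mregularAt (theta_mem_regularAt h) (map_C_mem_mregularAt _ _)),
    evM_smul (theta_mem_regularAt h) (map_C_mem_mregularAt _ _), evM_map_C, evM_map_C]

lemma basicGL_mem_loops {p : ℂ × Matrix (Fin n) (Fin n) ℂ} (h : ValidPair p) :
    basicGL p h ∈ loops n := by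
  refine mem_loops_of ?_ (fun t => basicLoop_mem_mregularAt p ?_) ?_
  · rw [basicGL_val, adj_basicLoop h, basicLoop_mul_basicLoop_conjPair h]
  · rintro h0
    exact h.1 (by rw [← h0, Complex.ofReal_im])
  · have h1 : Filter.Tendsto (fun a => (1 - p.2) + ev a (theta p.1) • p.2) (Filter.cocompact ℂ)
        (𝓝 ((1 - p.2) + (1 : ℂ) • p.2)) :=
      tendsto_const_nhds.add ((tendsto_ev_theta p.1).smul tendsto_const_nhds)
    rw [one_smul, sub_add_cancel] at h1
    refine h1.congr' ?_
    filter_upwards [(Set.finite_singleton p.1).isCompact.compl_mem_cocompact] with a ha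
    exact (evM_basicLoop p ha).symm

lemma hasPole_basicGL {p : ℂ × Matrix (Fin n) (Fin n) ℂ} {h : ValidPair p} {a : ℂ}
    (ha : HasPole (basicGL p h) a) : a = p.1 := by
  by_contra h'
  exact hasPole_iff.1 ha (basicLoop_mem_mregularAt p h')

lemma X_sub_C_smul_basicLoop (p : ℂ × Matrix (Fin n) (Fin n) ℂ) :
    (RatFunc.X - RatFunc.C p.1) • basicLoop p =
      (RatFunc.X - RatFunc.C p.1) • (1 - p.2).map RatFunc.C +
        (RatFunc.X - RatFunc.C (conj p.1)) • p.2.map RatFunc.C := by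
  rw [basicLoop, smul_add, smul_smul, X_sub_C_mul_theta]

lemma simplePole_basicGL {p : ℂ × Matrix (Fin n) (Fin n) ℂ} (h : ValidPair p) :
    SimplePole (basicGL p h) p.1 := by
  rw [simplePole_iff, basicGL_val, X_sub_C_smul_basicLoop]
  exact add_mem (smul_mem_mregularAt (X_sub_C_mem_regularAt _ _) (map_C_mem_mregularAt _ _))
    (smul_mem_mregularAt (X_sub_C_mem_regularAt _ _) (map_C_mem_mregularAt _ _))

lemma residue_basicGL {p : ℂ × Matrix (Fin n) (Fin n) ℂ} (h : ValidPair p) :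
    residue (basicGL p h) p.1 = (p.1 - conj p.1) • p.2 := by
  rw [residue_eq, basicGL_val, X_sub_C_smul_basicLoop, evM_add, evM_smul, evM_smul, ev_X_sub_C,
    ev_X_sub_C, evM_map_C, evM_map_C, sub_self, zero_smul, zero_add]
  all_goals
    first
    | exact X_sub_C_mem_regularAt _ _
    | exact map_C_mem_mregularAt _ _
    | exact smul_mem_mregularAt (X_sub_C_mem_regularAt _ _) (map_C_mem_mregularAt _ _)

lemma generic_basicGL {p : ℂ × Matrix (Fin n) (Fin n) ℂ} (h : ValidPair p) :
    Generic (basicGL p h) := by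
  intro a ha
  obtain rfl := hasPole_basicGL ha
  exact ⟨simplePole_basicGL h, fun h' => conj_ne_self h.1 (hasPole_basicGL h')⟩

/-- Since `basicLoop (conjPair p)` inverts the basic loop of a valid `p`, this says Φ^i = θ Φ⁻¹: up
to a scalar, i is inversion. -/
lemma basicLoopI_eq (p : ℂ × Matrix (Fin n) (Fin n) ℂ) :
    basicLoopI p = theta p.1 • basicLoop (conjPair p) := by
  rw [basicLoopI, basicLoop, conjPair, theta_conj, smul_add, smul_smul,
    mul_inv_cancel₀ (theta_ne_zero _), one_smul]

lemma validPair_one {α : ℂ} (h : α.im ≠ 0) :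
    ValidPair (α, (1 : Matrix (Fin n) (Fin n) ℂ)) := ⟨h, Matrix.isHermitian_one, mul_one 1⟩

lemma scal_thetaU {α : ℂ} (h : α.im ≠ 0) :
    scal n (thetaU α) = basicGL (α, 1) (validPair_one h) := by
  refine Units.ext ?_
  rw [scal_val, basicGL_val, basicLoop]
  simp [thetaU, Matrix.map_one]

/-! ### Factorisations -/

lemma isFactorisation_nil : IsFactorisation [] (1 : Mero n) := ⟨by simp, by simp⟩

lemma isFactorisation_nil_iff {φ : Mero n} : IsFactorisation [] φ ↔ φ = 1 :=
  ⟨fun h => Units.ext (by simpa using h.2), fun h => h ▸ isFactorisation_nil⟩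

lemma IsFactorisation.append {l l' : List (ℂ × Matrix (Fin n) (Fin n) ℂ)} {φ ψ : Mero n}
    (h : IsFactorisation l φ) (h' : IsFactorisation l' ψ) : IsFactorisation (l ++ l') (φ * ψ) := by
  refine ⟨fun p hp => (List.mem_append.1 hp).elim (h.1 p) (h'.1 p), ?_⟩
  rw [Units.val_mul, h.2, h'.2, List.map_append, List.prod_append]

lemma isFactorisation_singleton {p : ℂ × Matrix (Fin n) (Fin n) ℂ} (h : ValidPair p) :
    IsFactorisation [p] (basicGL p h) := ⟨by simpa using h, by simp [basicGL_val]⟩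

/-- Induction along a factorisation. -/
lemma IsFactorisation.induction
    {C : List (ℂ × Matrix (Fin n) (Fin n) ℂ) → Mero n → Prop} (nil : C [] 1)
    (cons : ∀ p l φ, ∀ h : ValidPair p, IsFactorisation l φ → C l φ →
      C (p :: l) (basicGL p h * φ)) :
    ∀ {l φ}, IsFactorisation l φ → C l φ
  | [], φ, h => by rwa [isFactorisation_nil_iff.1 h]
  | p :: l, φ, h => by
    have hp : ValidPair p := h.1 p (by simp)
    have h1 : IsFactorisation l ((basicGL p hp)⁻¹ * φ) := by
      refine ⟨fun q hq => h.1 q (by simp [hq]), ?_⟩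
      rw [Units.val_mul, h.2, List.map_cons, List.prod_cons, ← mul_assoc, ← basicGL_val hp,
        ← Units.val_mul, inv_mul_cancel, Units.val_one, one_mul]
    have := cons p l _ hp h1 (IsFactorisation.induction nil cons h1)
    rwa [mul_inv_cancel_left] at this

lemma exists_isFactorisation {l : List (ℂ × Matrix (Fin n) (Fin n) ℂ)}
    (h : ∀ p ∈ l, ValidPair p) : ∃ φ, IsFactorisation l φ := by
  induction l with
  | nil => exact ⟨1, isFactorisation_nil⟩
  | cons p l ih =>
    obtain ⟨φ, hφ⟩ := ih fun q hq => h q (by simp [hq])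
    exact ⟨_, (isFactorisation_singleton (h p (by simp))).append hφ⟩

lemma IsFactorisation.mem_loops {l : List (ℂ × Matrix (Fin n) (Fin n) ℂ)} {φ : Mero n}
    (h : IsFactorisation l φ) : φ ∈ loops n := by
  refine IsFactorisation.induction (C := fun _ φ => φ ∈ loops n) one_mem_loops ?_ h
  intro p l φ hp _ ih
  exact mul_mem_loops (basicGL_mem_loops hp) ih

lemma not_hasPole_one (a : ℂ) : ¬ HasPole (1 : Mero n) a := not_hasPole_iff.2 (one_mem _)

lemma IsFactorisation.mem_of_hasPole {l : List (ℂ × Matrix (Fin n) (Fin n) ℂ)} {φ : Mero n}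
    (h : IsFactorisation l φ) {a : ℂ} (ha : HasPole φ a) : a ∈ l.map Prod.fst := by
  revert ha
  refine IsFactorisation.induction (C := fun l φ => HasPole φ a → a ∈ l.map Prod.fst)
    (fun h => absurd h (not_hasPole_one a)) ?_ h
  intro p l φ hp _ ih ha
  rcases hasPole_of_mul ha with h1 | h1
  · simp [hasPole_basicGL h1]
  · simpa using Or.inr (by simpa using ih h1)

lemma IsFactorisation.inv {l : List (ℂ × Matrix (Fin n) (Fin n) ℂ)} {φ : Mero n}
    (h : IsFactorisation l φ) : IsFactorisation (l.reverse.map conjPair) φ⁻¹ := by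
  refine IsFactorisation.induction
    (C := fun l φ => IsFactorisation (l.reverse.map conjPair) φ⁻¹) ?_ ?_ h
  · simpa using isFactorisation_nil
  · intro p l φ hp _ ih
    rw [mul_inv_rev, List.reverse_cons, List.map_append, basicGL_inv]
    exact ih.append (isFactorisation_singleton hp.conjPair)

/-- The product of the functions `θ_α` over the factors. -/
def thetaProd (l : List (ℂ × Matrix (Fin n) (Fin n) ℂ)) : (RatFunc ℂ)ˣ :=
  ((l.map Prod.fst).map thetaU).prod

/-- Each factor contributes θ Φ⁻¹ and the scalars are central. An i-image therefore depends on the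
factorisation only through the multiset of its parameters α, not through the projections. -/
lemma IsFactorisation.prod_basicLoopI {l : List (ℂ × Matrix (Fin n) (Fin n) ℂ)} {φ : Mero n}
    (h : IsFactorisation l φ) :
    (l.reverse.map basicLoopI).prod = (scal n (thetaProd l) * φ⁻¹).val := by
  refine IsFactorisation.induction
    (C := fun l φ => (l.reverse.map basicLoopI).prod = (scal n (thetaProd l) * φ⁻¹).val) ?_ ?_ h
  · simp [thetaProd]
  · intro p l φ hp _ ih
    have h1 : basicLoopI p = (scal n (thetaU p.1) * (basicGL p hp)⁻¹).val := by
      rw [basicLoopI_eq, scal_mul_val, basicGL_inv, basicGL_val]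
      rfl
    have h2 : thetaProd (p :: l) = thetaU p.1 * thetaProd l := by simp [thetaProd]
    rw [List.reverse_cons, List.map_append, List.prod_append, ih, List.map_singleton,
      List.prod_singleton, h1, ← Units.val_mul, h2, map_mul, mul_inv_rev]
    congr 1
    rw [scal_mul_comm (thetaU p.1) (basicGL p hp)⁻¹, scal_mul_comm (thetaU p.1), mul_assoc,
      mul_assoc, scal_mul_comm (thetaU p.1), mul_assoc]

lemma isIImage_iff {φ ψ : Mero n} :
    IsIImage φ ψ ↔ ∃ l, IsMinFactorisation l φ ∧ ψ = scal n (thetaProd l) * φ⁻¹ := by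
  refine exists_congr fun l => and_congr_right fun h => ?_
  rw [h.1.prod_basicLoopI]
  exact ⟨fun h => Units.ext h, fun h => congrArg _ h⟩

lemma IsMinFactorisation.inv {l : List (ℂ × Matrix (Fin n) (Fin n) ℂ)} {φ : Mero n}
    (h : IsMinFactorisation l φ) : IsMinFactorisation (l.reverse.map conjPair) φ⁻¹ := by
  refine ⟨h.1.inv, fun l' hl' => ?_⟩
  have := h.2 _ (by simpa using hl'.inv)
  simpa using this

lemma thetaProd_inv (l : List (ℂ × Matrix (Fin n) (Fin n) ℂ)) :
    thetaProd (l.reverse.map conjPair) = (thetaProd l)⁻¹ := by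
  induction l with
  | nil => simp [thetaProd]
  | cons p l ih =>
    rw [thetaProd] at *
    simp only [List.reverse_cons, List.map_append, List.prod_append, ih]
    simp [thetaProd, conjPair, thetaU_conj, mul_comm]

lemma IsIImage.inv {φ ψ : Mero n} (h : IsIImage φ ψ) : IsIImage φ⁻¹ ψ⁻¹ := by
  rw [isIImage_iff] at *
  obtain ⟨l, hl, rfl⟩ := h
  refine ⟨_, hl.inv, ?_⟩
  rw [thetaProd_inv, map_inv, mul_inv_rev, inv_inv, ← map_inv, scal_mul_comm]

lemma isIImage_inv_iff {φ ψ : Mero n} : IsIImage φ ψ ↔ IsIImage φ⁻¹ ψ⁻¹ :=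
  ⟨IsIImage.inv, fun h => by simpa using h.inv⟩

/-! ### Self-adjoint projections -/

/-- P is the orthogonal projection onto the range of R in Euclidean space. The last clause transfers
left annihilators of R, such as the value of x⁻¹ at a pole, to P. -/
lemma exists_range_projection (R : Matrix (Fin n) (Fin n) ℂ) :
    ∃ P : Matrix (Fin n) (Fin n) ℂ, P.IsHermitian ∧ P * P = P ∧ (1 - P) * R = 0 ∧
      ∀ A : Matrix (Fin n) (Fin n) ℂ, A * R = 0 → A * P = 0 := by
  let e := Matrix.toEuclideanCLM (𝕜 := ℂ) (n := Fin n)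
  let K := LinearMap.range (e R).toLinearMap
  obtain ⟨P, hP⟩ : ∃ P, e P = K.starProjection := EquivLike.surjective e _
  have hK : IsStarProjection K.starProjection := isStarProjection_starProjection
  have hinj : Function.Injective e := EquivLike.injective e
  refine ⟨P, hinj ?_, hinj ?_, hinj ?_, fun A hA => hinj ?_⟩
  · rw [← Matrix.star_eq_conjTranspose, map_star, hP]
    exact hK.isSelfAdjoint
  · rw [map_mul, hP]
    exact hK.isIdempotentElem
  · rw [map_mul, map_sub, map_one, hP, map_zero]
    ext1 x
    have : K.starProjection (e R x) = e R x :=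
      Submodule.starProjection_eq_self_iff.2 ⟨x, rfl⟩
    simp [this]
  · rw [map_mul, hP, map_zero]
    ext1 x
    obtain ⟨y, hy⟩ := K.starProjection_apply_mem x
    have h0 : e A (e R y) = 0 := by
      have : e (A * R) y = 0 := by rw [hA, map_zero]; rfl
      rwa [map_mul] at this
    calc e A (K.starProjection x) = e A (e R y) := by rw [← hy]; rfl
      _ = 0 := h0

-- P = v v^* / (v^* v) for a kernel vector v of A. Then Φ_{α,P} = 1 + (θ_α - 1) P is a rank-one
-- perturbation of the identity, so its determinant is 1 + (θ_α - 1) tr P = θ_α.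
open scoped ComplexOrder in
lemma exists_rank_one_projection {A : Matrix (Fin n) (Fin n) ℂ} (hA : A.det = 0) :
    ∃ P : Matrix (Fin n) (Fin n) ℂ, P.IsHermitian ∧ P * P = P ∧ A * P = 0 ∧
      ∀ α, (basicLoop (α, P)).det = theta α := by
  obtain ⟨v, hv, hAv⟩ := Matrix.exists_mulVec_eq_zero_iff.2 hA
  have hc : star v ⬝ᵥ v ≠ 0 := fun h =>
    hv (dotProduct_star_self_eq_zero.1 h)
  have hs : star (star v ⬝ᵥ v) = star v ⬝ᵥ v := (Matrix.star_dotProduct v v).symm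
  refine ⟨(star v ⬝ᵥ v)⁻¹ • Matrix.vecMulVec v (star v), ?_, ?_, ?_, fun α => ?_⟩
  · rw [Matrix.IsHermitian, Matrix.conjTranspose_smul, star_inv₀, hs,
      Matrix.conjTranspose_vecMulVec, star_star]
  · rw [smul_mul_assoc, mul_smul_comm, Matrix.vecMulVec_mul_vecMulVec, smul_smul,
      Matrix.vecMulVec_smul, smul_smul]
    congr 1
    field_simp
  · rw [mul_smul_comm, Matrix.mul_vecMulVec, hAv, Matrix.zero_vecMulVec, smul_zero]
  · have h1 : basicLoop (α, (star v ⬝ᵥ v)⁻¹ • Matrix.vecMulVec v (star v)) =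
        1 + Matrix.replicateCol Unit (fun k => (theta α - 1) * RatFunc.C ((star v ⬝ᵥ v)⁻¹ * v k)) *
          Matrix.replicateRow Unit (fun k => RatFunc.C (star v k)) := by
      ext k l
      by_cases hkl : k = l <;>
      simp [basicLoop, Matrix.mul_apply, Matrix.vecMulVec_apply, hkl] <;> ring
    have h2 : ((fun k => RatFunc.C (star v k)) ⬝ᵥ
        fun k => (theta α - 1) * RatFunc.C ((star v ⬝ᵥ v)⁻¹ * v k)) = theta α - 1 := by
      have : (1 : RatFunc ℂ) = RatFunc.C (star v ⬝ᵥ v)⁻¹ * RatFunc.C (star v ⬝ᵥ v) := by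
        rw [← map_mul, inv_mul_cancel₀ hc, map_one]
      generalize (star v ⬝ᵥ v)⁻¹ = c at this ⊢
      refine Eq.trans ?_ ((congrArg ((theta α - 1) * ·) this.symm).trans (mul_one _))
      simp only [dotProduct, Finset.mul_sum, map_sum, map_mul]
      refine Finset.sum_congr rfl fun k _ => ?_
      ring
    rw [h1, Matrix.det_one_add_replicateCol_mul_replicateRow, h2]
    ring

/-! ### Half planes -/

lemma inv_mem_setG {s : Mero n} (h : s ∈ setM n) : s⁻¹ ∈ setG n :=
  ⟨inv_mem_loops h.1, fun a ha => by
    rw [hasPole_inv h.1]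
    exact h.2 _ (by simpa using ha)⟩

lemma inv_mem_setM {u : Mero n} (h : u ∈ setG n) : u⁻¹ ∈ setM n :=
  ⟨inv_mem_loops h.1, fun a ha => by
    rw [hasPole_inv h.1]
    exact h.2 _ (by simpa using ha)⟩

lemma im_neg_of_hasPole {u : Mero n} (h : u ∈ setG n) {a : ℂ} (ha : HasPole u a) : a.im < 0 :=
  lt_of_le_of_ne (not_lt.1 fun h' => h.2 a h' ha) (im_ne_zero_of_hasPole h.1 ha)

lemma im_pos_of_hasPole {s : Mero n} (h : s ∈ setM n) {a : ℂ} (ha : HasPole s a) : 0 < a.im :=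
  lt_of_le_of_ne (not_lt.1 fun h' => h.2 a h' ha) (im_ne_zero_of_hasPole h.1 ha).symm

lemma IsFactorisation.mem_setG {l : List (ℂ × Matrix (Fin n) (Fin n) ℂ)} {φ : Mero n}
    (h : IsFactorisation l φ) (hl : ∀ a ∈ l.map Prod.fst, a.im < 0) : φ ∈ setG n :=
  ⟨h.mem_loops, fun a ha h' => absurd (hl a (h.mem_of_hasPole h')) (not_lt.2 ha.le)⟩

lemma IsFactorisation.mem_setM {l : List (ℂ × Matrix (Fin n) (Fin n) ℂ)} {φ : Mero n}
    (h : IsFactorisation l φ) (hl : ∀ a ∈ l.map Prod.fst, 0 < a.im) : φ ∈ setM n :=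
  ⟨h.mem_loops, fun a ha h' => absurd (hl a (h.mem_of_hasPole h')) (not_lt.2 ha.le)⟩

/-! ### Every loop is a product of basic loops -/

/-- The only possibly singular term of u Φ at b is θ_b u P, and the zero of u P at b cancels the
simple pole of θ_b. -/
lemma not_hasPole_mul_basicGL {u : Mero n} {b : ℂ} {P : Matrix (Fin n) (Fin n) ℂ}
    (h : ValidPair (b, P)) (hu : ¬ HasPole u b) (hP : valueAt u b * P = 0) :
    ¬ HasPole (u * basicGL (b, P) h) b := by
  rw [not_hasPole_iff] at *
  have h1 : (u * basicGL (b, P) h).val = u.val * (1 - P).map RatFunc.C +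
      (RatFunc.X - RatFunc.C (conj b)) •
        ((RatFunc.X - RatFunc.C b)⁻¹ • (u.val * P.map RatFunc.C)) := by
    rw [Units.val_mul, basicGL_val, basicLoop, mul_add, mul_smul_comm, smul_smul, theta,
      div_eq_mul_inv]
  rw [h1]
  refine add_mem (mul_mem hu (map_C_mem_mregularAt _ _))
    (smul_mem_mregularAt (X_sub_C_mem_regularAt _ _)
      (inv_X_sub_C_smul_mem_mregularAt (mul_mem hu (map_C_mem_mregularAt _ _)) ?_))
  rw [evM_mul hu (map_C_mem_mregularAt _ _), evM_map_C]
  exact hP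

lemma det_adj (A : RMat n) : (adj A).det = conjR A.det := by
  rw [adj, Matrix.det_transpose, RingHom.map_det]
  rfl

/-- The relation d(λ) conj(d(conj λ)) = 1 forces a pole of d at conj b opposite the zero at b. Both
linear factors of θ_b thus cancel, one against the denominator of d and one against its numerator.
-/
lemma natDegree_num_mul_theta_lt {d : RatFunc ℂ} {b : ℂ} (hd : d * conjR d = 1)
    (hb : d ∈ regularAt b) (h0 : ev b d = 0) :
    (d * theta b).num.natDegree < d.num.natDegree := by
  have hd0 : d ≠ 0 := left_ne_zero_of_mul_eq_one hd
  have hp : d.num.eval b = 0 := by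
    simp only [ev, RatFunc.eval, Polynomial.eval₂_id] at h0
    exact (div_eq_zero_iff.1 h0).resolve_right hb
  have hq : d.denom.eval (conj b) = 0 := by
    by_contra hq
    have h1 : d ∈ regularAt (conj b) := hq
    have := congrArg (ev b) hd
    rw [ev_mul hb (conjR_mem_regularAt h1), h0, zero_mul] at this
    simp at this
  obtain ⟨p, hp⟩ := Polynomial.dvd_iff_isRoot.2 hp
  obtain ⟨q, hq⟩ := Polynomial.dvd_iff_isRoot.2 hq
  have hp0 : p ≠ 0 := by
    rintro rfl
    rw [mul_zero] at hp
    exact hd0 (RatFunc.num_eq_zero_iff.1 hp)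
  have hq0 : q ≠ 0 := by
    rintro rfl
    rw [mul_zero] at hq
    exact RatFunc.denom_ne_zero d hq
  have hq0' : algebraMap _ (RatFunc ℂ) q ≠ 0 := by
    rwa [Ne, FaithfulSMul.algebraMap_eq_zero_iff]
  have h1 : d * theta b = algebraMap _ (RatFunc ℂ) p / algebraMap _ (RatFunc ℂ) q := by
    conv_lhs => rw [← RatFunc.num_div_denom d, hp, hq, map_mul, map_mul, ← X_sub_C_eq,
      ← X_sub_C_eq, theta]
    have := X_sub_C_ne_zero b
    have := X_sub_C_ne_zero (conj b)
    field_simp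
  rw [h1]
  refine lt_of_le_of_lt (Polynomial.natDegree_le_of_dvd (RatFunc.num_div_dvd p hq0) hp0) ?_
  rw [hp, Polynomial.natDegree_mul (Polynomial.X_sub_C_ne_zero b) hp0,
    Polynomial.natDegree_X_sub_C]
  omega

/-- Induction on the degree of the numerator of det u: a zero b in the upper half plane is divided
out by Φ_{b,P}, whose inverse has its parameter at conj b, in the lower half plane. -/
lemma exists_isFactorisation_of_mem_setG {u : Mero n} (hu : u ∈ setG n) :
    ∃ l, IsFactorisation l u ∧ ∀ a ∈ l.map Prod.fst, a.im < 0 := by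
  induction hk : u.val.det.num.natDegree using Nat.strong_induction_on generalizing u with
  | _ k ih =>
    by_cases hb : ∃ b : ℂ, 0 < b.im ∧ ev b u.val.det = 0
    · obtain ⟨b, hb, h0⟩ := hb
      have hub := hu.2 b hb
      rw [ev_det (not_hasPole_iff.1 hub)] at h0
      obtain ⟨P, h1, h2, h3, h4⟩ := exists_rank_one_projection h0
      have hP : ValidPair (b, P) := ⟨hb.ne', h1, h2⟩
      have hu' : u * basicGL (b, P) hP ∈ setG n := by
        refine ⟨mul_mem_loops hu.1 (basicGL_mem_loops hP), fun a ha => ?_⟩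
        by_cases hab : a = b
        · rw [hab]
          exact not_hasPole_mul_basicGL hP hub h3
        · exact not_hasPole_mul (hu.2 a ha) fun h => hab (hasPole_basicGL h)
      have hlt : (u * basicGL (b, P) hP).val.det.num.natDegree < k := by
        rw [Units.val_mul, Matrix.det_mul, basicGL_val, h4, ← hk]
        refine natDegree_num_mul_theta_lt ?_ (det_mem_regularAt (not_hasPole_iff.1 hub)) ?_
        · rw [← det_adj, ← Matrix.det_mul, loops_mul_adj hu.1, Matrix.det_one]
        · rwa [ev_det (not_hasPole_iff.1 hub)]
      obtain ⟨l, hl, hl'⟩ := ih _ hlt hu' rfl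
      refine ⟨l ++ [conjPair (b, P)], ?_, ?_⟩
      · have := hl.append (isFactorisation_singleton hP.conjPair)
        rwa [← basicGL_inv hP, mul_inv_cancel_right] at this
      · intro a ha
        simp only [List.map_append, List.mem_append, List.map_singleton, List.mem_singleton] at ha
        rcases ha with ha | rfl
        · exact hl' a ha
        · simpa [conjPair] using hb
    -- With no zero of det u in the upper half plane, Cramer's rule makes u⁻¹ regular there, so u is
    -- regular in the lower half plane too and Liouville applies.
    · push Not at hb
      have h1 : ∀ a : ℂ, 0 < a.im → ¬ HasPole u⁻¹ a := fun a ha => by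
        rw [not_hasPole_iff, Matrix.coe_units_inv, Matrix.inv_def, Ring.inverse_eq_inv']
        exact smul_mem_mregularAt (inv_mem_regularAt (hb a ha))
          (adjugate_mem_mregularAt (not_hasPole_iff.1 (hu.2 a ha)))
      have h2 : u = 1 := by
        refine eq_one_of_no_pole hu.1 fun a ha => ?_
        refine h1 (conj a) (by simpa using im_neg_of_hasPole hu ha) ?_
        rwa [hasPole_inv hu.1, Complex.conj_conj]
      exact ⟨[], isFactorisation_nil_iff.2 h2, by simp⟩

lemma exists_isFactorisation_of_mem_setM {s : Mero n} (hs : s ∈ setM n) :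
    ∃ l, IsFactorisation l s ∧ ∀ a ∈ l.map Prod.fst, 0 < a.im := by
  obtain ⟨l, hl, h⟩ := exists_isFactorisation_of_mem_setG (inv_mem_setG hs)
  refine ⟨_, by simpa using hl.inv, ?_⟩
  intro a ha
  simp only [List.map_reverse, List.map_map, List.mem_reverse, List.mem_map,
    Function.comp_apply] at ha
  obtain ⟨p, hp, rfl⟩ := ha
  simpa [conjPair] using h p.1 (List.mem_map_of_mem hp)

/-- Here q clears the poles of x in the upper half plane. A root b of q there is traded for the
scalar factor θ_b in M: dividing x by θ_b multiplies by (λ - b)/(λ - conj b), which uses up the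
factor λ - b of q and is regular in the upper half plane. -/
lemma exists_setG_mul_scal {x : Mero n} (hx : x ∈ loops n) {q : Polynomial ℂ} (hq : q ≠ 0)
    (h : ∀ a : ℂ, 0 < a.im → algebraMap _ (RatFunc ℂ) q • x.val ∈ mregularAt n a) :
    ∃ u ∈ setG n, ∃ s ∈ setM n, x = u * s := by
  induction hk : q.natDegree using Nat.strong_induction_on generalizing q x with
  | _ k ih =>
    by_cases hb : ∃ b : ℂ, 0 < b.im ∧ q.eval b = 0
    · obtain ⟨b, hb, h0⟩ := hb
      obtain ⟨q, rfl⟩ := Polynomial.dvd_iff_isRoot.2 h0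
      have hq' : q ≠ 0 := right_ne_zero_of_mul hq
      have hθ : scal n (thetaU b) ∈ loops n := by
        rw [scal_thetaU hb.ne']
        exact basicGL_mem_loops _
      have hx' : scal n (thetaU b)⁻¹ * x ∈ loops n := by
        rw [map_inv]
        exact mul_mem_loops (inv_mem_loops hθ) hx
      obtain ⟨u, hu, s, hs, hus⟩ := ih q.natDegree (by
        rw [← hk, Polynomial.natDegree_mul (Polynomial.X_sub_C_ne_zero b) hq',
          Polynomial.natDegree_X_sub_C]
        omega) hx' hq' (fun a ha => by
        have h1 : algebraMap _ (RatFunc ℂ) q • (scal n (thetaU b)⁻¹ * x).val =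
            (RatFunc.X - RatFunc.C (conj b))⁻¹ •
              (algebraMap _ (RatFunc ℂ) ((Polynomial.X - Polynomial.C b) * q) • x.val) := by
          rw [scal_mul_val, smul_smul, smul_smul, map_mul, ← X_sub_C_eq]
          congr 1
          simp only [thetaU, Units.val_inv_eq_inv_val, Units.val_mk0, theta, inv_div]
          rw [div_eq_mul_inv]
          ring
        rw [h1]
        refine smul_mem_mregularAt (inv_mem_regularAt ?_) (h a ha)
        rw [ev_X_sub_C, sub_ne_zero]
        rintro rfl
        rw [Complex.conj_im] at ha
        linarith) rfl
      refine ⟨u, hu, scal n (thetaU b) * s, ?_, ?_⟩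
      · refine ⟨mul_mem_loops hθ hs.1, fun a ha => not_hasPole_mul ?_ (hs.2 a ha)⟩
        rw [scal_thetaU hb.ne']
        intro h'
        rw [hasPole_basicGL h'] at ha
        exact absurd ha (not_lt.2 hb.le)
      · rw [scal_mul_comm, ← mul_assoc, ← hus, scal_mul_comm, mul_assoc, ← map_mul,
          inv_mul_cancel, map_one, mul_one]
    · push Not at hb
      refine ⟨x, ⟨hx, fun a ha => ?_⟩, 1, ⟨one_mem_loops, fun a _ => not_hasPole_one a⟩,
        (mul_one x).symm⟩
      have hq0 : algebraMap _ (RatFunc ℂ) q ≠ 0 := by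
        rwa [Ne, FaithfulSMul.algebraMap_eq_zero_iff]
      have := smul_mem_mregularAt (inv_mem_regularAt (f := algebraMap _ (RatFunc ℂ) q)
        (by rw [ev_algebraMap]; exact hb a ha)) (h a ha)
      rwa [smul_smul, inv_mul_cancel₀ hq0, one_smul, ← not_hasPole_iff] at this

/-- Every loop is a product of an element of `G` and an element of `M`. -/
lemma exists_setG_mul_setM {x : Mero n} (hx : x ∈ loops n) :
    ∃ u ∈ setG n, ∃ s ∈ setM n, x = u * s := by
  refine exists_setG_mul_scal hx (q := ∏ k, ∏ l, (x.val k l).denom)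
    (Finset.prod_ne_zero_iff.2 fun k _ => Finset.prod_ne_zero_iff.2 fun l _ =>
      RatFunc.denom_ne_zero _) fun a _ k l => ?_
  have hdvd : (x.val k l).denom ∣ ∏ k, ∏ l, (x.val k l).denom :=
    (Finset.dvd_prod_of_mem (fun l => (x.val k l).denom) (Finset.mem_univ l)).trans
      (Finset.dvd_prod_of_mem (fun k => ∏ l, (x.val k l).denom) (Finset.mem_univ k))
  obtain ⟨r, hr⟩ := hdvd
  have h0 : algebraMap _ (RatFunc ℂ) (x.val k l).denom ≠ 0 := by
    rw [Ne, FaithfulSMul.algebraMap_eq_zero_iff]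
    exact RatFunc.denom_ne_zero _
  have : algebraMap _ (RatFunc ℂ) (∏ k, ∏ l, (x.val k l).denom) * x.val k l =
      algebraMap _ (RatFunc ℂ) (r * (x.val k l).num) := by
    rw [hr, map_mul, map_mul]
    nth_rewrite 2 [← RatFunc.num_div_denom (x.val k l)]
    field_simp
  rw [Matrix.smul_apply, smul_eq_mul, this]
  exact algebraMap_mem_regularAt _ _

lemma exists_isFactorisation_of_mem_loops {x : Mero n} (hx : x ∈ loops n) :
    ∃ l, IsFactorisation l x := by
  obtain ⟨u, hu, s, hs, rfl⟩ := exists_setG_mul_setM hx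
  obtain ⟨l, hl, -⟩ := exists_isFactorisation_of_mem_setG hu
  obtain ⟨l', hl', -⟩ := exists_isFactorisation_of_mem_setM hs
  exact ⟨_, hl.append hl'⟩

lemma exists_isMinFactorisation {x : Mero n} (hx : x ∈ loops n) :
    ∃ l, IsMinFactorisation l x := by
  have h : ∃ k, ∃ l, IsFactorisation l x ∧ l.length = k := by
    obtain ⟨l, hl⟩ := exists_isFactorisation_of_mem_loops hx
    exact ⟨_, l, hl, rfl⟩
  classical
  obtain ⟨l, hl, hk⟩ := Nat.find_spec h
  exact ⟨l, hl, fun l' hl' => hk ▸ Nat.find_min' h ⟨l', hl', rfl⟩⟩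

/-! ### Factorisation of generic loops -/

/-- x⁻¹ is regular at a, and the product x⁻¹ x = 1 has no residue there. -/
lemma valueAt_inv_mul_residue {x : Mero n} (hx : x ∈ loops n) {a : ℂ} (hs : SimplePole x a)
    (hc : ¬ HasPole x (conj a)) : valueAt x⁻¹ a * residue x a = 0 := by
  have h1 : ¬ HasPole x⁻¹ a := by rwa [hasPole_inv hx]
  rw [← residue_mul_right h1 hs, inv_mul_cancel, residue_eq, Units.val_one,
    evM_smul (X_sub_C_mem_regularAt _ _) (one_mem _), ev_X_sub_C, sub_self, zero_smul]

/-- A pole of a generic loop is split off by a basic loop. -/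
lemma exists_split_pole {x : Mero n} (hx : x ∈ loops n) (hg : Generic x) {a : ℂ}
    (ha : HasPole x a) : ∃ P, ∃ h : ValidPair (a, P), Generic ((basicGL (a, P) h)⁻¹ * x) ∧
      poles ((basicGL (a, P) h)⁻¹ * x) = (poles x).erase a := by
  obtain ⟨hs, hc⟩ := hg a ha
  obtain ⟨P, h1, h2, h3, h4⟩ := exists_range_projection (residue x a)
  have hP : ValidPair (a, P) := ⟨im_ne_zero_of_hasPole hx ha, h1, h2⟩
  have hinv : ¬ HasPole x⁻¹ a := by rwa [hasPole_inv hx]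
  set y := (basicGL (a, P) hP)⁻¹ * x with hy
  have hyl : y ∈ loops n := mul_mem_loops (inv_mem_loops (basicGL_mem_loops hP)) hx
  -- Write Φ⁻¹ = (1 - P) + θ_{conj a} P. The first term kills the residue of x, and in the second
  -- the zero of θ_{conj a} at a absorbs the simple pole.
  have hya : ¬ HasPole y a := by
    have h5 : y.val = (RatFunc.X - RatFunc.C a)⁻¹ • ((1 - P).map RatFunc.C *
        ((RatFunc.X - RatFunc.C a) • x.val)) + (RatFunc.X - RatFunc.C (conj a))⁻¹ •
          (P.map RatFunc.C * ((RatFunc.X - RatFunc.C a) • x.val)) := by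
      rw [hy, basicGL_inv, Units.val_mul, basicGL_val, basicLoop, conjPair, add_mul, mul_smul_comm,
        mul_smul_comm, smul_smul, smul_smul, inv_mul_cancel₀ (X_sub_C_ne_zero a), one_smul, theta,
        smul_mul_assoc, Complex.conj_conj, div_eq_mul_inv, mul_comm (_ - _)]
    rw [not_hasPole_iff, h5]
    refine add_mem (inv_X_sub_C_smul_mem_mregularAt
      (mul_mem (map_C_mem_mregularAt _ _) (simplePole_iff.1 hs)) ?_) (smul_mem_mregularAt
        (inv_mem_regularAt ?_) (mul_mem (map_C_mem_mregularAt _ _) (simplePole_iff.1 hs)))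
    · rw [evM_mul (map_C_mem_mregularAt _ _) (simplePole_iff.1 hs), evM_map_C]
      exact h3
    · rw [ev_X_sub_C, sub_ne_zero]
      exact (conj_ne_self hP.1).symm
  -- A pole of y at conj a is a pole of y⁻¹ = x⁻¹ Φ at a; there is none because x⁻¹(a) kills the
  -- residue and therefore P.
  have hyc : ¬ HasPole y (conj a) := by
    rw [← hasPole_inv hyl, hy, mul_inv_rev, inv_inv]
    exact not_hasPole_mul_basicGL hP hinv (h4 _ (valueAt_inv_mul_residue hx hs hc))
  have hb1 : ∀ b, b ≠ a → ¬ HasPole (basicGL (a, P) hP) b := fun b hb h => hb (hasPole_basicGL h)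
  have hb2 : ∀ b, b ≠ conj a → ¬ HasPole (basicGL (a, P) hP)⁻¹ b := fun b hb h => by
    rw [basicGL_inv] at h
    exact hb (hasPole_basicGL h)
  have hyx : ∀ b, HasPole y b ↔ b ≠ a ∧ HasPole x b := by
    intro b
    by_cases h : b = a
    · simp [h, hya]
    by_cases h' : b = conj a
    · simp [h', hyc, hc]
    refine ⟨fun hb => ⟨h, (hasPole_of_mul hb).resolve_left (hb2 b h')⟩, fun hb => ?_⟩
    have hxy : x = basicGL (a, P) hP * y := by rw [hy, mul_inv_cancel_left]
    exact (hasPole_of_mul (hxy ▸ hb.2)).resolve_left (hb1 b h)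
  refine ⟨P, hP, fun b hb => ?_, ?_⟩
  · have hb' := ((hyx b).1 hb).2
    refine ⟨simplePole_mul_right (hb2 b ?_) (hg b hb').1, fun h => (hg b hb').2 ((hyx _).1 h).2⟩
    rintro rfl
    exact hc hb'
  · ext b
    rw [mem_poles, hyx, Finset.mem_erase, mem_poles]

/-- A generic loop is a product of basic loops with its poles in any prescribed order. -/
lemma exists_isFactorisation_of_generic {x : Mero n} (hx : x ∈ loops n) (hg : Generic x)
    {L : List ℂ} (hL : L.Nodup) (hLx : L.toFinset = poles x) :
    ∃ l, IsFactorisation l x ∧ l.map Prod.fst = L := by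
  induction L generalizing x with
  | nil =>
    refine ⟨[], isFactorisation_nil_iff.2 (eq_one_of_no_pole hx fun a ha => ?_), rfl⟩
    rw [← mem_poles, ← hLx] at ha
    simp at ha
  | cons a L ih =>
    have ha : HasPole x a := by rw [← mem_poles, ← hLx]; simp
    obtain ⟨P, hP, hy, hp⟩ := exists_split_pole hx hg ha
    obtain ⟨l, hl, h⟩ := ih (mul_mem_loops (inv_mem_loops (basicGL_mem_loops hP)) hx) hy
      hL.of_cons (by
        rw [hp, ← hLx, List.toFinset_cons, Finset.erase_insert]
        simpa using (List.nodup_cons.1 hL).1)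
    refine ⟨(a, P) :: l, ?_, by simp [h]⟩
    have := (isFactorisation_singleton hP).append hl
    rwa [mul_inv_cancel_left] at this

lemma IsFactorisation.poles_subset {l : List (ℂ × Matrix (Fin n) (Fin n) ℂ)} {x : Mero n}
    (h : IsFactorisation l x) : poles x ⊆ (l.map Prod.fst).toFinset := fun a ha => by
  rw [List.mem_toFinset]
  exact h.mem_of_hasPole (mem_poles.1 ha)

/-- Pigeonhole, applied with `F` the poles of x and `L` the parameters of a factorisation: if it has
at most as many factors as x has poles, each pole is used exactly once. -/
lemma nodup_of_length_le_card {L : List ℂ} {F : Finset ℂ} (h : F ⊆ L.toFinset)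
    (hl : L.length ≤ F.card) : L.Nodup ∧ L.toFinset = F := by
  have h1 := Finset.card_le_card h
  have h2 := L.toFinset_card_le
  have h3 : F = L.toFinset := Finset.eq_of_subset_of_card_le h (h2.trans hl)
  refine ⟨?_, h3.symm⟩
  rw [← Multiset.coe_nodup]
  refine Multiset.toFinset_card_eq_card_iff_nodup.1 ?_
  exact le_antisymm h2 (hl.trans h1)

/-- The product of the functions `θ_a` over the poles `a`. -/
def thetaPoles (x : Mero n) : (RatFunc ℂ)ˣ := ∏ a ∈ poles x, thetaU a

lemma thetaProd_eq_of_generic {l : List (ℂ × Matrix (Fin n) (Fin n) ℂ)} {x : Mero n}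
    (hg : Generic x) (h : IsMinFactorisation l x) : thetaProd l = thetaPoles x := by
  obtain ⟨l', hl', h'⟩ := exists_isFactorisation_of_generic h.1.mem_loops hg
    (poles x).nodup_toList (Finset.toList_toFinset _)
  have hlen : (l.map Prod.fst).length ≤ (poles x).card := by
    rw [List.length_map, ← Finset.length_toList, ← h', List.length_map]
    exact h.2 l' hl'
  obtain ⟨h1, h2⟩ := nodup_of_length_le_card h.1.poles_subset hlen
  rw [thetaProd, thetaPoles, ← h2, List.prod_toFinset _ h1]

lemma isIImage_iff_of_generic {x y : Mero n} (hx : x ∈ loops n) (hg : Generic x) :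
    IsIImage x y ↔ y = scal n (thetaPoles x) * x⁻¹ := by
  rw [isIImage_iff]
  constructor
  · rintro ⟨l, hl, rfl⟩
    rw [thetaProd_eq_of_generic hg hl]
  · rintro rfl
    obtain ⟨l, hl⟩ := exists_isMinFactorisation hx
    exact ⟨l, hl, by rw [thetaProd_eq_of_generic hg hl]⟩

lemma iOp_eq {x : Mero n} (hx : x ∈ loops n) (hg : Generic x) :
    iOp x = scal n (thetaPoles x) * x⁻¹ := by
  have h : IsIImage x (scal n (thetaPoles x) * x⁻¹) := (isIImage_iff_of_generic hx hg).2 rfl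
  exact (isIImage_iff_of_generic hx hg).1 (Classical.epsilon_spec ⟨_, h⟩)

/-! ### Products of generic loops -/

lemma Separated.symm {φ ψ : Mero n} (h : Separated φ ψ) : Separated ψ φ := fun a b ha hb =>
  ⟨(h b a hb ha).1.symm, fun h' => (h b a hb ha).2 (by rw [h', Complex.conj_conj])⟩

lemma Separated.mono {φ ψ φ' ψ' : Mero n} (h : Separated φ ψ)
    (h1 : ∀ a, HasPole φ' a → HasPole φ a) (h2 : ∀ a, HasPole ψ' a → HasPole ψ a) :
    Separated φ' ψ' := fun a b ha hb => h a b (h1 a ha) (h2 b hb)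

lemma Separated.not_hasPole {φ ψ : Mero n} (h : Separated φ ψ) {a : ℂ} (ha : HasPole φ a) :
    ¬ HasPole ψ a := fun h' => (h a a ha h').1 rfl

lemma Separated.not_hasPole_inv {φ ψ : Mero n} (h : Separated φ ψ) (hψ : ψ ∈ loops n) {a : ℂ}
    (ha : HasPole φ a) : ¬ HasPole ψ⁻¹ a := fun h' =>
  (h a _ ha ((hasPole_inv hψ).1 h')).2 (Complex.conj_conj a).symm

/-- No pole cancels: in φ = (φψ)ψ⁻¹ the poles of ψ⁻¹ are conjugates of poles of ψ, which separation
keeps away from those of φ; symmetrically for ψ. -/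
lemma Separated.hasPole_mul_iff {φ ψ : Mero n} (h : Separated φ ψ) (hφ : φ ∈ loops n)
    (hψ : ψ ∈ loops n) {a : ℂ} : HasPole (φ * ψ) a ↔ HasPole φ a ∨ HasPole ψ a := by
  refine ⟨hasPole_of_mul, ?_⟩
  rintro (ha | ha)
  · have h1 : HasPole (φ * ψ * ψ⁻¹) a := by rwa [mul_inv_cancel_right]
    exact (hasPole_of_mul h1).resolve_right (h.not_hasPole_inv hψ ha)
  · have h1 : HasPole (φ⁻¹ * (φ * ψ)) a := by rwa [inv_mul_cancel_left]
    exact (hasPole_of_mul h1).resolve_left (h.symm.not_hasPole_inv hφ ha)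

lemma Generic.mul {φ ψ : Mero n} (hφ : φ ∈ loops n) (hψ : ψ ∈ loops n) (gφ : Generic φ)
    (gψ : Generic ψ) (h : Separated φ ψ) : Generic (φ * ψ) := by
  intro a ha
  rw [h.hasPole_mul_iff hφ hψ] at ha ⊢
  rcases ha with ha | ha
  · refine ⟨simplePole_mul_left (gφ a ha).1 (h.not_hasPole ha), ?_⟩
    rintro (h' | h')
    · exact (gφ a ha).2 h'
    · exact (h a _ ha h').2 (Complex.conj_conj a).symm
  · refine ⟨simplePole_mul_right (h.symm.not_hasPole ha) (gψ a ha).1, ?_⟩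
    rintro (h' | h')
    · exact (h _ a h' ha).2 rfl
    · exact (gψ a ha).2 h'

lemma Generic.inv {φ : Mero n} (hφ : φ ∈ loops n) (h : Generic φ) : Generic φ⁻¹ := by
  intro a ha
  rw [hasPole_inv hφ] at ha
  rw [hasPole_inv hφ, simplePole_inv hφ]
  exact h _ ha

lemma NoScalarFactor.mul {φ ψ : Mero n} (hφ : φ ∈ loops n) (hψ : ψ ∈ loops n) (gφ : Generic φ)
    (gψ : Generic ψ) (h : Separated φ ψ) (nφ : NoScalarFactor φ) (nψ : NoScalarFactor ψ) :
    NoScalarFactor (φ * ψ) := by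
  intro a ha
  rw [h.hasPole_mul_iff hφ hψ] at ha
  rcases ha with ha | ha
  · rw [residue_mul_left (gφ a ha).1 (h.not_hasPole ha), Matrix.det_mul, nφ a ha, zero_mul]
  · rw [residue_mul_right (h.symm.not_hasPole ha) (gψ a ha).1, Matrix.det_mul, nψ a ha, mul_zero]

/-! ### Factorisation of generic loops into `G` and `M` -/

/-- `x = u s` with `u ∈ G`, `s ∈ M`, where the poles of the factors are poles of `x`. -/
structure PoleFactors (x u s : Mero n) : Prop where
  mem_setG : u ∈ setG n
  mem_setM : s ∈ setM n
  eq_mul : x = u * s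
  left : ∀ a, HasPole u a → HasPole x a
  right : ∀ a, HasPole s a → HasPole x a

/-- A pole of u'⁻¹ u = s' s⁻¹ comes from one factor on each side. Of the four combinations, two put
a point in both half planes and two give conjugate poles of x, so the quotient is 1. -/
lemma PoleFactors.unique {x u s u' s' : Mero n} (hg : Generic x) (h : PoleFactors x u s)
    (h' : PoleFactors x u' s') : u = u' ∧ s = s' := by
  have he : u'⁻¹ * u = s' * s⁻¹ := by
    rw [eq_mul_inv_iff_mul_eq, mul_assoc, ← h.eq_mul, h'.eq_mul, inv_mul_cancel_left]
  have h1 : u'⁻¹ * u = 1 := by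
    refine eq_one_of_no_pole (mul_mem_loops (inv_mem_loops h'.mem_setG.1) h.mem_setG.1) ?_
    intro a ha
    have ha' := ha
    rw [he] at ha'
    rcases hasPole_of_mul ha with h1 | h1 <;> rcases hasPole_of_mul ha' with h2 | h2
    · rw [hasPole_inv h'.mem_setG.1] at h1
      exact (hg a (h'.right a h2)).2 (h'.left _ h1)
    · rw [hasPole_inv h'.mem_setG.1] at h1
      rw [hasPole_inv h.mem_setM.1] at h2
      exact lt_asymm (im_neg_of_hasPole h'.mem_setG h1) (im_pos_of_hasPole h.mem_setM h2)
    · exact lt_asymm (im_neg_of_hasPole h.mem_setG h1) (im_pos_of_hasPole h'.mem_setM h2)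
    · rw [hasPole_inv h.mem_setM.1] at h2
      exact (hg a (h.left a h1)).2 (h.right _ h2)
  have h2 := he.symm.trans h1
  exact ⟨(inv_mul_eq_one.1 h1).symm, (mul_inv_eq_one.1 h2).symm⟩

/-- At a pole of s the loop u⁻¹ is regular, since otherwise x would have conjugate poles; so s = u⁻¹
x inherits simplicity from x, and similarly u = x s⁻¹. -/
lemma PoleFactors.inDomain {x u s : Mero n} (hg : Generic x) (h : PoleFactors x u s) :
    InDomain s u := by
  refine ⟨h.mem_setM, h.mem_setG, fun a ha => ?_, fun a ha => ?_, fun a b ha hb => ?_⟩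
  · have hx := hg a (h.right a ha)
    refine ⟨?_, fun h' => hx.2 (h.right _ h')⟩
    have : s = u⁻¹ * x := by rw [h.eq_mul, inv_mul_cancel_left]
    rw [this]
    refine simplePole_mul_right ?_ hx.1
    rw [hasPole_inv h.mem_setG.1]
    exact fun h' => hx.2 (h.left _ h')
  · have hx := hg a (h.left a ha)
    refine ⟨?_, fun h' => hx.2 (h.left _ h')⟩
    have : u = x * s⁻¹ := by rw [h.eq_mul, mul_inv_cancel_right]
    rw [this]
    refine simplePole_mul_left hx.1 ?_
    rw [hasPole_inv h.mem_setM.1]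
    exact fun h' => hx.2 (h.right _ h')
  · constructor
    · rintro rfl
      exact lt_asymm (im_neg_of_hasPole h.mem_setG hb) (im_pos_of_hasPole h.mem_setM ha)
    · rintro rfl
      exact (hg b (h.left b hb)).2 (h.right _ ha)

/-- The poles may be split off in any order. Taking those in the lower half plane first, the product
is cut into a G part and an M part. -/
lemma exists_factorsGM {x : Mero n} (hx : x ∈ loops n) (hg : Generic x) :
    ∃ u s, FactorsGM x u s (poles x).card := by
  set L₁ := ((poles x).filter fun a => a.im < 0).toList with hL₁
  set L₂ := ((poles x).filter fun a => ¬ a.im < 0).toList with hL₂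
  have hnd : (L₁ ++ L₂).Nodup := by
    refine List.Nodup.append (Finset.nodup_toList _) (Finset.nodup_toList _) fun a h1 h2 => ?_
    rw [hL₁, Finset.mem_toList, Finset.mem_filter] at h1
    rw [hL₂, Finset.mem_toList, Finset.mem_filter] at h2
    exact h2.2 h1.2
  have hfin : (L₁ ++ L₂).toFinset = poles x := by
    rw [List.toFinset_append, hL₁, hL₂, Finset.toList_toFinset, Finset.toList_toFinset,
      Finset.filter_union_filter_not_eq]
  obtain ⟨l, hl, hlL⟩ := exists_isFactorisation_of_generic hx hg hnd hfin
  obtain ⟨l₁, l₂, rfl, h1, h2⟩ := List.map_eq_append_iff.1 hlL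
  obtain ⟨u, hu⟩ := exists_isFactorisation fun p hp => hl.1 p (List.mem_append_left l₂ hp)
  obtain ⟨s, hs⟩ := exists_isFactorisation fun p hp => hl.1 p (List.mem_append_right l₁ hp)
  refine ⟨u, s, hu.mem_setG ?_, hs.mem_setM ?_, Units.ext (hl.2.trans (hu.append hs).2.symm),
    l₁, l₂, hu, hs, ?_⟩
  · rw [h1]
    intro a ha
    rw [hL₁, Finset.mem_toList, Finset.mem_filter] at ha
    exact ha.2
  · rw [h2]
    intro a ha
    rw [hL₂, Finset.mem_toList, Finset.mem_filter, mem_poles] at ha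
    exact lt_of_le_of_ne (not_lt.1 ha.2) (im_ne_zero_of_hasPole hx ha.1).symm
  · rw [← List.length_append, ← List.length_map (f := Prod.fst), hlL, ← hfin,
      List.toFinset_card_of_nodup hnd]

lemma IsMinFactorsGM.poleFactors {x u s : Mero n} (hx : x ∈ loops n) (hg : Generic x)
    (h : IsMinFactorsGM x u s) : PoleFactors x u s := by
  obtain ⟨k, ⟨hu, hs, rfl, l, l', hl, hl', rfl⟩, hmin⟩ := h
  obtain ⟨u', s', hk⟩ := exists_factorsGM hx hg
  have hlen := hmin u' s' _ hk
  rw [← List.length_append, ← List.length_map (f := Prod.fst)] at hlen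
  obtain ⟨-, h2⟩ := nodup_of_length_le_card (hl.append hl').poles_subset hlen
  refine ⟨hu, hs, rfl, fun a ha => ?_, fun a ha => ?_⟩
  · rw [← mem_poles, ← h2, List.mem_toFinset, List.map_append]
    exact List.mem_append_left _ (hl.mem_of_hasPole ha)
  · rw [← mem_poles, ← h2, List.mem_toFinset, List.map_append]
    exact List.mem_append_right _ (hl'.mem_of_hasPole ha)

lemma exists_isMinFactorsGM {x : Mero n} (hx : x ∈ loops n) :
    ∃ p : Mero n × Mero n, IsMinFactorsGM x p.1 p.2 := by
  have h : ∃ k, ∃ u s, FactorsGM x u s k := by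
    obtain ⟨u, hu, s, hs, rfl⟩ := exists_setG_mul_setM hx
    obtain ⟨l, hl⟩ := exists_isFactorisation_of_mem_loops hu.1
    obtain ⟨l', hl'⟩ := exists_isFactorisation_of_mem_loops hs.1
    exact ⟨_, u, s, hu, hs, rfl, l, l', hl, hl', rfl⟩
  classical
  obtain ⟨u, s, hk⟩ := Nat.find_spec h
  exact ⟨(u, s), _, hk, fun u' s' k' h' => Nat.find_min' h ⟨u', s', h'⟩⟩

/-- For the converse no factors are counted: a minimal factorisation exists, its factors have only
poles of x, and by uniqueness it is the given one. -/
lemma isMinFactorsGM_iff {x u s : Mero n} (hx : x ∈ loops n) (hg : Generic x) :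
    IsMinFactorsGM x u s ↔ PoleFactors x u s := by
  refine ⟨fun h => h.poleFactors hx hg, fun h => ?_⟩
  obtain ⟨⟨u', s'⟩, h'⟩ := exists_isMinFactorsGM hx
  obtain ⟨rfl, rfl⟩ := h.unique hg (h'.poleFactors hx hg)
  exact h'

/-! ### The actions on the domain -/

lemma InDomain.mul_mem_loops {s u : Mero n} (h : InDomain s u) : s * u ∈ loops n :=
  MeroLoop.mul_mem_loops h.1.1 h.2.1.1

lemma InDomain.generic_mul {s u : Mero n} (h : InDomain s u) : Generic (s * u) :=
  h.2.2.1.mul h.1.1 h.2.1.1 h.2.2.2.1 h.2.2.2.2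

lemma InDomain.hasPole_mul_iff {s u : Mero n} (h : InDomain s u) {a : ℂ} :
    HasPole (s * u) a ↔ HasPole s a ∨ HasPole u a :=
  h.2.2.2.2.hasPole_mul_iff h.1.1 h.2.1.1

lemma InDomain.generic_mul' {s u : Mero n} (h : InDomain s u) : Generic (u * s) :=
  h.2.2.2.1.mul h.2.1.1 h.1.1 h.2.2.1 h.2.2.2.2.symm

lemma InDomain.hasPole_mul_iff' {s u : Mero n} (h : InDomain s u) {a : ℂ} :
    HasPole (u * s) a ↔ HasPole u a ∨ HasPole s a :=
  h.2.2.2.2.symm.hasPole_mul_iff h.2.1.1 h.1.1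

lemma InDomain.poleFactors {s u : Mero n} (h : InDomain s u) : PoleFactors (u * s) u s :=
  ⟨h.2.1, h.1, rfl, fun _ ha => h.hasPole_mul_iff'.2 (.inl ha),
    fun _ ha => h.hasPole_mul_iff'.2 (.inr ha)⟩

lemma InDomain.mono {s u s' u' : Mero n} (h : InDomain s u) (hs : s' ∈ setM n)
    (hu : u' ∈ setG n) (gs : Generic s') (gu : Generic u') (h1 : ∀ a, HasPole s' a → HasPole s a)
    (h2 : ∀ a, HasPole u' a → HasPole u a) : InDomain s' u' :=
  ⟨hs, hu, gs, gu, h.2.2.2.2.mono h1 h2⟩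

lemma InDomain.actions_spec {s u : Mero n} (h : InDomain s u) :
    PoleFactors (s * u) (lact s u) (ract s u) :=
  (isMinFactorsGM_iff h.mul_mem_loops h.generic_mul).1
    (Classical.epsilon_spec (exists_isMinFactorsGM h.mul_mem_loops))

lemma InDomain.actions_eq {s u u' s' : Mero n} (h : InDomain s u)
    (h' : PoleFactors (s * u) u' s') : lact s u = u' ∧ ract s u = s' :=
  h.actions_spec.unique h.generic_mul h'

lemma InDomain.actions {s u : Mero n} (h : InDomain s u) : InDomain (ract s u) (lact s u) :=
  h.actions_spec.inDomain h.generic_mul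

/-- The poles of s u are those of s and u together, and the half planes sort them. Thus the actions
do not move poles, which keeps iterated actions inside the domain. -/
lemma InDomain.hasPole_lact {s u : Mero n} (h : InDomain s u) {a : ℂ} :
    HasPole (lact s u) a ↔ HasPole u a := by
  have h' := h.actions_spec
  constructor
  · intro ha
    refine (h.hasPole_mul_iff.1 (h'.left a ha)).resolve_left fun hs => ?_
    exact lt_asymm (im_neg_of_hasPole h'.mem_setG ha) (im_pos_of_hasPole h.1 hs)
  · intro ha
    have h1 := h.hasPole_mul_iff.2 (.inr ha)
    rw [h'.eq_mul] at h1
    refine (hasPole_of_mul h1).resolve_right fun hs => ?_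
    exact lt_asymm (im_neg_of_hasPole h.2.1 ha) (im_pos_of_hasPole h'.mem_setM hs)

lemma InDomain.hasPole_ract {s u : Mero n} (h : InDomain s u) {a : ℂ} :
    HasPole (ract s u) a ↔ HasPole s a := by
  have h' := h.actions_spec
  constructor
  · intro ha
    refine (h.hasPole_mul_iff.1 (h'.right a ha)).resolve_right fun hs => ?_
    exact lt_asymm (im_neg_of_hasPole h.2.1 hs) (im_pos_of_hasPole h'.mem_setM ha)
  · intro ha
    have h1 := h.hasPole_mul_iff.2 (.inl ha)
    rw [h'.eq_mul] at h1
    refine (hasPole_of_mul h1).resolve_left fun hs => ?_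
    exact lt_asymm (im_neg_of_hasPole h'.mem_setG hs) (im_pos_of_hasPole h.1 ha)

/-! ### The operation `i` on generic loops -/

lemma scal_thetaPoles_mem_loops {x : Mero n} (hx : x ∈ loops n) :
    scal n (thetaPoles x) ∈ loops n := by
  refine ((loopGroup n).comap (scal n)).prod_mem fun a ha => ?_
  change scal n (thetaU a) ∈ loops n
  rw [scal_thetaU (im_ne_zero_of_hasPole hx (mem_poles.1 ha))]
  exact basicGL_mem_loops _

lemma iOp_mem_loops {x : Mero n} (hx : x ∈ loops n) (hg : Generic x) : iOp x ∈ loops n := by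
  rw [iOp_eq hx hg]
  exact mul_mem_loops (scal_thetaPoles_mem_loops hx) (inv_mem_loops hx)

lemma prod_theta_mem_regularAt {F : Finset ℂ} {b : ℂ} (h : b ∉ F) :
    ((∏ a ∈ F, thetaU a : (RatFunc ℂ)ˣ) : RatFunc ℂ) ∈ regularAt b := by
  rw [Units.coe_prod]
  refine prod_mem fun a ha => theta_mem_regularAt ?_
  rintro rfl
  exact h ha

lemma not_hasPole_scal_thetaPoles {x : Mero n} {b : ℂ} (h : ¬ HasPole x b) :
    ¬ HasPole (scal n (thetaPoles x)) b := by
  rw [not_hasPole_iff, scal_val]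
  exact smul_mem_mregularAt (prod_theta_mem_regularAt fun h' => h (mem_poles.1 h')) (one_mem _)

/-- Near a pole `a`, `x^i` is `f θ_a x⁻¹` with `f` regular at `a` and `conj a` and nonzero at
`a`. -/
lemma exists_iOp_val_eq {x : Mero n} (hx : x ∈ loops n) (hg : Generic x) {a : ℂ}
    (ha : HasPole x a) : ∃ f : RatFunc ℂ, f ∈ regularAt a ∧ f ∈ regularAt (conj a) ∧ ev a f ≠ 0 ∧
      (iOp x).val = (f * theta a) • (x⁻¹).val := by
  set f : (RatFunc ℂ)ˣ := ∏ b ∈ (poles x).erase a, thetaU b with hf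
  have h1 : (f : RatFunc ℂ) ∈ regularAt a := prod_theta_mem_regularAt (by simp)
  -- θ_b⁻¹ = θ_{conj b} has its pole at conj b, which by genericity is not a. Regularity of both f
  -- and f⁻¹ at a gives f(a) ≠ 0.
  have h2 : ((f⁻¹ : (RatFunc ℂ)ˣ) : RatFunc ℂ) ∈ regularAt a := by
    rw [hf, ← Finset.prod_inv_distrib, Units.coe_prod]
    refine prod_mem fun b hb => ?_
    rw [← thetaU_conj]
    refine theta_mem_regularAt ?_
    rintro rfl
    exact (hg b (mem_poles.1 (Finset.mem_of_mem_erase hb))).2 ha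
  refine ⟨f, h1, prod_theta_mem_regularAt fun h => ?_, fun h0 => ?_, ?_⟩
  · exact (hg a ha).2 (mem_poles.1 (Finset.mem_of_mem_erase h))
  · have h3 := ev_mul h1 h2
    rw [← Units.val_mul, mul_inv_cancel, h0, zero_mul, Units.val_one] at h3
    simp at h3
  · rw [iOp_eq hx hg, scal_mul_val, thetaPoles, ← Finset.prod_erase_mul _ _ (mem_poles.2 ha)]
    rfl

lemma simplePole_iOp {x : Mero n} (hx : x ∈ loops n) (hg : Generic x) {a : ℂ}
    (ha : HasPole x a) : SimplePole (iOp x) a ∧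
      ∃ c : ℂ, c ≠ 0 ∧ residue (iOp x) a = c • valueAt x⁻¹ a := by
  obtain ⟨f, h1, -, h3, h4⟩ := exists_iOp_val_eq hx hg ha
  have h5 : (RatFunc.X - RatFunc.C a) • (iOp x).val =
      (f * (RatFunc.X - RatFunc.C (conj a))) • (x⁻¹).val := by
    rw [h4, smul_smul, ← X_sub_C_mul_theta a]
    congr 1
    ring
  have h6 : (x⁻¹).val ∈ mregularAt n a := by
    rw [← not_hasPole_iff, hasPole_inv hx]
    exact (hg a ha).2
  have h7 : f * (RatFunc.X - RatFunc.C (conj a)) ∈ regularAt a :=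
    mul_mem h1 (X_sub_C_mem_regularAt _ _)
  refine ⟨?_, ev a f * (a - conj a), ?_, ?_⟩
  · rw [simplePole_iff, h5]
    exact smul_mem_mregularAt h7 h6
  · exact mul_ne_zero h3 (sub_ne_zero.2 (conj_ne_self (im_ne_zero_of_hasPole hx ha)).symm)
  · rw [residue_eq, h5, evM_smul h7 h6, ev_mul h1 (X_sub_C_mem_regularAt _ _), ev_X_sub_C]
    rfl

/-- The inverse x⁻¹ contributes simple poles at the conjugates of the poles of x, and the zeros of
the functions θ_a cancel them. -/
lemma hasPole_of_hasPole_iOp {x : Mero n} (hx : x ∈ loops n) (hg : Generic x) {b : ℂ}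
    (hb : HasPole (iOp x) b) : HasPole x b := by
  by_contra h
  by_cases hc : HasPole x (conj b)
  · obtain ⟨f, -, h2, -, h4⟩ := exists_iOp_val_eq hx hg hc
    rw [Complex.conj_conj] at h2
    refine hasPole_iff.1 hb ?_
    have h5 : (iOp x).val = (f * (RatFunc.X - RatFunc.C (conj b))⁻¹) •
        ((RatFunc.X - RatFunc.C b) • (x⁻¹).val) := by
      rw [h4, smul_smul, theta, Complex.conj_conj]
      congr 1
      rw [div_eq_mul_inv]
      ring
    rw [h5]
    refine smul_mem_mregularAt (mul_mem h2 (inv_mem_regularAt ?_))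
      (simplePole_iff.1 ((simplePole_inv hx).2 (hg _ hc).1))
    rw [ev_X_sub_C, sub_ne_zero]
    exact fun h' => h (by rwa [h'])
  · rw [iOp_eq hx hg] at hb
    refine not_hasPole_mul (not_hasPole_scal_thetaPoles h) ?_ hb
    rwa [hasPole_inv hx]

lemma generic_iOp {x : Mero n} (hx : x ∈ loops n) (hg : Generic x) : Generic (iOp x) :=
  fun a ha => ⟨(simplePole_iOp hx hg (hasPole_of_hasPole_iOp hx hg ha)).1, fun h =>
    (hg a (hasPole_of_hasPole_iOp hx hg ha)).2 (hasPole_of_hasPole_iOp hx hg h)⟩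

lemma not_hasPole_of_residue_eq_zero {x : Mero n} {a : ℂ} (h : SimplePole x a)
    (h0 : residue x a = 0) : ¬ HasPole x a := by
  have := inv_X_sub_C_smul_mem_mregularAt (simplePole_iff.1 h) h0
  rwa [smul_smul, inv_mul_cancel₀ (X_sub_C_ne_zero a), one_smul, ← not_hasPole_iff] at this

/-- The residue of x^i at a is a multiple of x⁻¹(a), which is singular because it annihilates the
nonzero residue of x. -/
lemma noScalarFactor_iOp {x : Mero n} (hx : x ∈ loops n) (hg : Generic x) :
    NoScalarFactor (iOp x) := by
  intro a ha
  have hxa := hasPole_of_hasPole_iOp hx hg ha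
  obtain ⟨-, c, -, hc⟩ := simplePole_iOp hx hg hxa
  obtain ⟨hs, hn⟩ := hg a hxa
  have h1 := valueAt_inv_mul_residue hx hs hn
  have h2 : (valueAt x⁻¹ a).det = 0 := by
    by_contra hd
    refine not_hasPole_of_residue_eq_zero hs ?_ hxa
    have hu : IsUnit (valueAt x⁻¹ a) := (Matrix.isUnit_iff_isUnit_det _).2 (isUnit_iff_ne_zero.2 hd)
    exact hu.mul_right_eq_zero.1 h1
  rw [hc, Matrix.det_smul, h2, mul_zero]

/-- If x^i were regular at a pole a of x, then x⁻¹(a) = 0. So x⁻¹/(λ - a) would be regular at a and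
inverse to (λ - a) x, making the residue of x invertible. -/
lemma hasPole_iOp_iff {x : Mero n} (hx : x ∈ loops n) (hg : Generic x) (hn : NoScalarFactor x)
    {a : ℂ} : HasPole (iOp x) a ↔ HasPole x a := by
  refine ⟨hasPole_of_hasPole_iOp hx hg, fun ha => ?_⟩
  by_contra hi
  obtain ⟨hs, c, hc0, hc⟩ := simplePole_iOp hx hg ha
  have h1 : residue (iOp x) a = 0 := by
    rw [residue_eq, evM_smul (X_sub_C_mem_regularAt _ _) (not_hasPole_iff.1 hi), ev_X_sub_C,
      sub_self, zero_smul]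
  have h2 : valueAt x⁻¹ a = 0 := (smul_eq_zero.1 (hc.symm.trans h1)).resolve_left hc0
  have h3 : (x⁻¹).val ∈ mregularAt n a := by
    rw [← not_hasPole_iff, hasPole_inv hx]
    exact (hg a ha).2
  have h4 := inv_X_sub_C_smul_mem_mregularAt h3 h2
  have h5 : ((RatFunc.X - RatFunc.C a)⁻¹ • (x⁻¹).val) *
      ((RatFunc.X - RatFunc.C a) • x.val) = 1 := by
    rw [smul_mul_smul_comm, inv_mul_cancel₀ (X_sub_C_ne_zero a), one_smul, ← Units.val_mul,
      inv_mul_cancel, Units.val_one]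
  have h6 := congrArg (fun A => (evM a A).det) h5
  simp only [evM_mul h4 (simplePole_iff.1 (hg a ha).1), evM_one, Matrix.det_mul,
    Matrix.det_one] at h6
  rw [← residue_eq, hn a ha, mul_zero] at h6
  exact zero_ne_one h6

lemma thetaPoles_congr {x y : Mero n} (h : ∀ a, HasPole x a ↔ HasPole y a) :
    thetaPoles x = thetaPoles y := by
  have : poles x = poles y := by
    ext a
    rw [mem_poles, mem_poles, h]
  rw [thetaPoles, this, thetaPoles]

lemma Separated.thetaPoles_mul {φ ψ : Mero n} (h : Separated φ ψ) (hφ : φ ∈ loops n)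
    (hψ : ψ ∈ loops n) : thetaPoles (φ * ψ) = thetaPoles φ * thetaPoles ψ := by
  classical
  have h1 : poles (φ * ψ) = poles φ ∪ poles ψ := by
    ext a
    rw [Finset.mem_union, mem_poles, mem_poles, mem_poles, h.hasPole_mul_iff hφ hψ]
  rw [thetaPoles, h1, Finset.prod_union]
  · rfl
  · exact Finset.disjoint_left.2 fun a ha hb =>
      h.not_hasPole (mem_poles.1 ha) (mem_poles.1 hb)

lemma iOp_iOp {x : Mero n} (hx : x ∈ loops n) (hg : Generic x) (hn : NoScalarFactor x) :
    iOp (iOp x) = x := by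
  rw [iOp_eq (iOp_mem_loops hx hg) (generic_iOp hx hg),
    thetaPoles_congr fun a => hasPole_iOp_iff hx hg hn, iOp_eq hx hg, mul_inv_rev, inv_inv,
    scal_mul_comm, mul_assoc, inv_mul_cancel, mul_one]

lemma iOp_mul {φ ψ : Mero n} (hφ : φ ∈ loops n) (hψ : ψ ∈ loops n) (gφ : Generic φ)
    (gψ : Generic ψ) (h : Separated φ ψ) : iOp (φ * ψ) = iOp ψ * iOp φ := by
  rw [iOp_eq (mul_mem_loops hφ hψ) (gφ.mul hφ hψ gψ h), iOp_eq hφ gφ, iOp_eq hψ gψ,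
    h.thetaPoles_mul hφ hψ, map_mul, mul_inv_rev, ← mul_assoc, ← mul_assoc,
    mul_assoc (scal n _) ψ⁻¹, ← scal_mul_comm (thetaPoles φ) ψ⁻¹, ← mul_assoc,
    scal_mul_comm (thetaPoles φ) (scal n (thetaPoles ψ))]

lemma iOp_inv {x : Mero n} (hx : x ∈ loops n) (hg : Generic x) : iOp x⁻¹ = (iOp x)⁻¹ := by
  have h1 : IsIImage x (iOp x) := (isIImage_iff_of_generic hx hg).2 (iOp_eq hx hg)
  have h2 := (isIImage_iff_of_generic (inv_mem_loops hx) (hg.inv hx)).1 h1.inv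
  rw [h2, iOp_eq (inv_mem_loops hx) (hg.inv hx)]

lemma InDomain.iOp {s u : Mero n} (h : InDomain s u) : InDomain (iOp s) (iOp u) := by
  have ⟨hs, hu, gs, gu, _⟩ := h
  exact h.mono
    ⟨iOp_mem_loops hs.1 gs, fun a ha h' => hs.2 a ha (hasPole_of_hasPole_iOp hs.1 gs h')⟩
    ⟨iOp_mem_loops hu.1 gu, fun a ha h' => hu.2 a ha (hasPole_of_hasPole_iOp hu.1 gu h')⟩
    (generic_iOp hs.1 gs) (generic_iOp hu.1 gu)
    (fun _ => hasPole_of_hasPole_iOp hs.1 gs) (fun _ => hasPole_of_hasPole_iOp hu.1 gu)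

/-! ### Density -/

/-- Telescope φψ - φ'ψ' = (φ - φ')ψ + φ'(ψ - ψ'); entries of unitary matrices have modulus at most
1, and each entry of the product is a sum of n terms. -/
lemma CloseOnReal.mul {φ φ' ψ ψ' : Mero n} {ε δ : ℝ} (hφ : φ ∈ loops n) (hφ' : φ' ∈ loops n)
    (hψ : ψ ∈ loops n) (hψ' : ψ' ∈ loops n) (h : CloseOnReal ε φ φ') (h' : CloseOnReal δ ψ ψ') :
    CloseOnReal (n * (ε + δ)) (φ * ψ) (φ' * ψ') := by
  intro t k l
  have e1 : valueAt (φ * ψ) (t : ℂ) = valueAt φ t * valueAt ψ t :=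
    evM_mul (loops_regular_real hφ t) (loops_regular_real hψ t)
  have e2 : valueAt (φ' * ψ') (t : ℂ) = valueAt φ' t * valueAt ψ' t :=
    evM_mul (loops_regular_real hφ' t) (loops_regular_real hψ' t)
  have e3 : valueAt (φ * ψ) (t : ℂ) k l - valueAt (φ' * ψ') (t : ℂ) k l =
      ∑ j, ((valueAt φ t k j - valueAt φ' t k j) * valueAt ψ t j l +
        valueAt φ' t k j * (valueAt ψ t j l - valueAt ψ' t j l)) := by
    rw [e1, e2, Matrix.mul_apply, Matrix.mul_apply, ← Finset.sum_sub_distrib]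
    exact Finset.sum_congr rfl fun j _ => by ring
  rw [e3]
  refine (norm_sum_le _ _).trans_lt ?_
  have e4 : (n : ℝ) * (ε + δ) = ∑ _j : Fin n, (ε + δ) := by
    rw [Finset.sum_const, Finset.card_univ, Fintype.card_fin, nsmul_eq_mul]
  rw [e4]
  refine Finset.sum_lt_sum_of_nonempty ⟨k, Finset.mem_univ k⟩ fun j _ => ?_
  refine (norm_add_le _ _).trans_lt (add_lt_add_of_lt_of_le ?_ ?_)
  · rw [norm_mul]
    exact (mul_le_of_le_one_right (norm_nonneg _)
      (entry_norm_bound_of_unitary (hψ.1 t).2 j l)).trans_lt (h t k j)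
  · rw [norm_mul]
    exact (mul_le_of_le_one_left (norm_nonneg _)
      (entry_norm_bound_of_unitary (hφ'.1 t).2 k j)).trans (h' t j l).le

lemma CloseOnReal.mono {φ ψ : Mero n} {ε δ : ℝ} (h : CloseOnReal ε φ ψ) (hεδ : ε ≤ δ) :
    CloseOnReal δ φ ψ := fun t k l => (h t k l).trans_le hεδ

/-- For real t, |t - conj α| = |t - α|, so only the denominator t - β survives, and |t - β| ≥ |Im β|
makes the bound uniform in t. -/
lemma norm_ev_theta_sub_le {α β : ℂ} (hα : α.im ≠ 0) (hβ : β.im ≠ 0) (t : ℝ) :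
    ‖ev (t : ℂ) (theta α) - ev (t : ℂ) (theta β)‖ ≤ 2 * ‖β - α‖ / |β.im| := by
  have h1 : ∀ γ : ℂ, γ.im ≠ 0 → (t : ℂ) ≠ γ := by
    rintro γ h rfl
    exact h (Complex.ofReal_im t)
  have h2 : (t : ℂ) - α ≠ 0 := sub_ne_zero.2 (h1 α hα)
  have h3 : (t : ℂ) - β ≠ 0 := sub_ne_zero.2 (h1 β hβ)
  have h4 : (t : ℂ) - conj α = conj ((t : ℂ) - α) := by simp
  have h5 : ev (t : ℂ) (theta α) - ev (t : ℂ) (theta β) =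
      conj (β - α) / (t - β) - (β - α) * (t - conj α) / ((t - α) * (t - β)) := by
    rw [ev_theta (h1 α hα), ev_theta (h1 β hβ), map_sub]
    field_simp
    ring
  have h6 : |β.im| ≤ ‖(t : ℂ) - β‖ := by
    have := Complex.abs_im_le_norm ((t : ℂ) - β)
    simpa using this
  have h7 : 0 < |β.im| := abs_pos.2 hβ
  have h8 : ‖conj (β - α) / (t - β)‖ = ‖β - α‖ / ‖(t : ℂ) - β‖ := by
    rw [norm_div, RCLike.norm_conj]
  have h9 : ‖(β - α) * (t - conj α) / ((t - α) * (t - β))‖ = ‖β - α‖ / ‖(t : ℂ) - β‖ := by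
    rw [norm_div, norm_mul, norm_mul, h4, RCLike.norm_conj]
    have : ‖(t : ℂ) - α‖ ≠ 0 := norm_ne_zero_iff.2 h2
    have : ‖(t : ℂ) - β‖ ≠ 0 := norm_ne_zero_iff.2 h3
    field_simp
  rw [h5]
  refine (norm_sub_le _ _).trans ?_
  rw [h8, h9, ← two_mul, ← mul_div_assoc]
  gcongr

lemma exists_close_basicGL {α : ℂ} {P : Matrix (Fin n) (Fin n) ℂ} (h : ValidPair (α, P)) {ε : ℝ}
    (hε : 0 < ε) {F : Set ℂ} (hF : F.Finite) :
    ∃ β, ∃ h' : ValidPair (β, P), β ∉ F ∧ 0 < α.im * β.im ∧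
      CloseOnReal ε (basicGL (α, P) h) (basicGL (β, P) h') := by
  have hα : α.im ≠ 0 := h.1
  set C : ℝ := ∑ k, ∑ l, ‖P k l‖ with hC
  have hC0 : 0 ≤ C := Finset.sum_nonneg fun k _ => Finset.sum_nonneg fun l _ => norm_nonneg _
  have hm : 0 < |α.im| := abs_pos.2 hα
  -- The first bound keeps β in the half plane of α with |Im β| ≥ |Im α|/2. The second makes
  -- (2δ/(|Im α|/2)) (C + 1) ≤ ε, where C + 1 avoids division by zero.
  set δ : ℝ := min (|α.im| / 2) (ε * |α.im| / (4 * (C + 1))) with hδ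
  have hδ0 : 0 < δ := by positivity
  obtain ⟨β, hβ, hβF⟩ : (Metric.ball α δ \ F).Nonempty := by
    refine ((infinite_of_mem_nhds α (Metric.ball_mem_nhds α hδ0)).sdiff hF).nonempty
  rw [mem_ball_iff_norm] at hβ
  have h1 : |β.im - α.im| ≤ ‖β - α‖ := by
    simpa using Complex.abs_im_le_norm (β - α)
  have h2 : |β.im - α.im| < |α.im| / 2 := h1.trans_lt (hβ.trans_le (min_le_left _ _))
  have h3 : |α.im| / 2 ≤ |β.im| := by
    have := abs_sub_abs_le_abs_sub α.im β.im
    rw [abs_sub_comm] at this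
    linarith
  have h4 : β.im ≠ 0 := abs_pos.1 (by linarith)
  have h5 : 0 < α.im * β.im := by
    rcases lt_or_gt_of_ne hα with h | h
    · rw [abs_of_neg h, abs_lt] at h2
      exact mul_pos_of_neg_of_neg h (by linarith)
    · rw [abs_of_pos h, abs_lt] at h2
      exact mul_pos h (by linarith)
  have hv : ValidPair (β, P) := ⟨h4, h.2⟩
  refine ⟨β, hv, hβF, h5, fun t k l => ?_⟩
  have ht : ∀ γ : ℂ, γ.im ≠ 0 → (t : ℂ) ≠ γ := by
    rintro γ h rfl
    exact h (Complex.ofReal_im t)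
  have e1 : valueAt (basicGL (α, P) h) (t : ℂ) k l - valueAt (basicGL (β, P) hv) (t : ℂ) k l =
      (ev (t : ℂ) (theta α) - ev (t : ℂ) (theta β)) * P k l := by
    rw [valueAt_eq, valueAt_eq, basicGL_val h, basicGL_val hv, evM_basicLoop _ (ht α hα),
      evM_basicLoop _ (ht β h4)]
    simp only [Matrix.add_apply, Matrix.smul_apply, smul_eq_mul]
    ring
  have e2 : ‖P k l‖ ≤ C := by
    refine le_trans ?_ (Finset.single_le_sum (f := fun k => ∑ l, ‖P k l‖)
      (fun k _ => Finset.sum_nonneg fun l _ => norm_nonneg _) (Finset.mem_univ k))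
    exact Finset.single_le_sum (f := fun l => ‖P k l‖) (fun l _ => norm_nonneg _)
      (Finset.mem_univ l)
  rw [e1, norm_mul]
  have e3 : ‖β - α‖ < ε * |α.im| / (4 * (C + 1)) := hβ.trans_le (min_le_right _ _)
  rw [lt_div_iff₀ (by positivity)] at e3
  calc ‖ev (t : ℂ) (theta α) - ev (t : ℂ) (theta β)‖ * ‖P k l‖
      ≤ (2 * ‖β - α‖ / (|α.im| / 2)) * (C + 1) := by
        refine mul_le_mul ((norm_ev_theta_sub_le hα h4 t).trans ?_) (e2.trans (by linarith))
          (norm_nonneg _) (by positivity)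
        gcongr
    _ = ‖β - α‖ * (4 * (C + 1)) / |α.im| := by
        field_simp
        ring
    _ < ε := by rwa [div_lt_iff₀ hm]

lemma det_eq_zero_of_idempotent {P : Matrix (Fin n) (Fin n) ℂ} (h : P * P = P) (h1 : P ≠ 1) :
    P.det = 0 := by
  by_contra hd
  have hu : IsUnit P := (Matrix.isUnit_iff_isUnit_det _).2 (isUnit_iff_ne_zero.2 hd)
  exact h1 (hu.mul_left_cancel (by rw [h, mul_one]))

lemma noScalarFactor_basicGL {p : ℂ × Matrix (Fin n) (Fin n) ℂ} (h : ValidPair p)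
    (h1 : p.2 ≠ 1) : NoScalarFactor (basicGL p h) := by
  intro a ha
  rw [hasPole_basicGL ha, residue_basicGL, Matrix.det_smul,
    det_eq_zero_of_idempotent h.2.2 h1, mul_zero]

/-- A product of basic loops is approximated by moving the poles into general position. -/
lemma IsFactorisation.exists_generic_close {l : List (ℂ × Matrix (Fin n) (Fin n) ℂ)} {φ : Mero n}
    (h : IsFactorisation l φ) {ε : ℝ} (hε : 0 < ε) {F : Set ℂ} (hF : F.Finite) :
    ∃ φ' ∈ loops n, Generic φ' ∧ CloseOnReal ε φ φ' ∧
      (∀ a, HasPole φ' a → a ∉ F ∧ ∃ α ∈ l.map Prod.fst, 0 < α.im * a.im) ∧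
      ((∀ p ∈ l, p.2 ≠ 1) → NoScalarFactor φ') := by
  revert ε
  refine IsFactorisation.induction (C := fun l φ => ∀ {ε : ℝ}, 0 < ε →
    ∃ φ' ∈ loops n, Generic φ' ∧ CloseOnReal ε φ φ' ∧
      (∀ a, HasPole φ' a → a ∉ F ∧ ∃ α ∈ l.map Prod.fst, 0 < α.im * a.im) ∧
      ((∀ p ∈ l, p.2 ≠ 1) → NoScalarFactor φ')) ?_ ?_ h
  · intro ε hε
    exact ⟨1, one_mem_loops, fun a ha => absurd ha (not_hasPole_one a),
      fun t k l => by simpa using hε, fun a ha => absurd ha (not_hasPole_one a),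
      fun _ a ha => absurd ha (not_hasPole_one a)⟩
  · rintro ⟨α, P⟩ l φ hp hl ih ε hε
    -- With this error in each factor the product has error ε n/(n + 1) ≤ ε; n + 1 allows n = 0.
    have hε' : 0 < ε / (2 * (n + 1)) := by positivity
    obtain ⟨φ', h1, h2, h3, h4, h5⟩ := ih hε'
    -- Avoiding the poles already placed and their conjugates separates the new factor from the
    -- rest, which keeps the product generic.
    obtain ⟨β, hβ, h6, h7, h8⟩ := exists_close_basicGL hp hε'
      ((hF.union (finite_hasPole φ')).union ((finite_hasPole φ').image (starRingEnd ℂ)))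
    have hsep : Separated (basicGL (β, P) hβ) φ' := by
      intro a b ha hb
      obtain rfl := hasPole_basicGL ha
      constructor
      · rintro rfl
        exact h6 (.inl (.inr hb))
      · intro h'
        exact h6 (.inr ⟨b, hb, h'.symm⟩)
    have hβl := basicGL_mem_loops hβ
    refine ⟨basicGL (β, P) hβ * φ', mul_mem_loops hβl h1,
      (generic_basicGL hβ).mul hβl h1 h2 hsep, ?_, fun a ha => ?_, fun hn => ?_⟩
    · refine (h8.mul (basicGL_mem_loops hp) hβl hl.mem_loops h1 h3).mono ?_
      have : (n : ℝ) * (ε / (2 * (n + 1)) + ε / (2 * (n + 1))) = ε * (n / (n + 1)) := by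
        field_simp
        ring
      rw [this]
      refine mul_le_of_le_one_right hε.le ?_
      rw [div_le_one (by positivity)]
      linarith
    · rcases hasPole_of_mul ha with h' | h'
      · obtain rfl := hasPole_basicGL h'
        exact ⟨fun h'' => h6 (.inl (.inl h'')), α, by simp, h7⟩
      · obtain ⟨h9, α', h10, h11⟩ := h4 a h'
        exact ⟨h9, α', by rw [List.map_cons]; exact List.mem_cons_of_mem _ h10, h11⟩
    · exact NoScalarFactor.mul hβl h1 (generic_basicGL hβ) h2 hsep
        (noScalarFactor_basicGL hβ (hn (α, P) (by simp)))
        (h5 fun q hq => hn q (List.mem_cons_of_mem _ hq))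

lemma basicLoop_mul_basicLoop_compl {α : ℂ} {Q : Matrix (Fin n) (Fin n) ℂ} (h : Q * Q = Q) :
    basicLoop (α, Q) * basicLoop (α, 1 - Q) = basicLoop (α, 1) := by
  have h1 : ((1 - Q) * (1 - Q)) = 1 - Q := by rw [mul_sub, sub_mul, sub_mul, h]; simp
  have h2 : (1 - Q) * Q = 0 := by rw [sub_mul, h]; simp
  have h3 : Q * (1 - Q) = 0 := by rw [mul_sub, h]; simp
  simp only [basicLoop, add_mul, mul_add, smul_mul_assoc, mul_smul_comm, ← Matrix.map_mul,
    sub_sub_cancel, h1, h2, h3, h]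
  ext k l
  by_cases hkl : k = l
  · simp [hkl]
    ring
  · simp [hkl]

/-- In dimension at least two a scalar factor splits into two nonscalar ones. -/
lemma IsFactorisation.exists_nonscalar (hn : 2 ≤ n) {l : List (ℂ × Matrix (Fin n) (Fin n) ℂ)}
    {φ : Mero n} (h : IsFactorisation l φ) : ∃ l', IsFactorisation l' φ ∧
      (∀ p ∈ l', p.2 ≠ 1) ∧ ∀ a ∈ l'.map Prod.fst, a ∈ l.map Prod.fst := by
  refine IsFactorisation.induction (C := fun l φ => ∃ l', IsFactorisation l' φ ∧
      (∀ p ∈ l', p.2 ≠ 1) ∧ ∀ a ∈ l'.map Prod.fst, a ∈ l.map Prod.fst) ?_ ?_ h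
  · exact ⟨[], isFactorisation_nil, by simp, by simp⟩
  · rintro ⟨α, P⟩ l φ hp hl ⟨l', h1, h2, h3⟩
    by_cases hP : P = 1
    · subst hP
      -- The projection onto the first coordinate; since n ≥ 2 neither Q nor 1 - Q is the identity.
      let Q : Matrix (Fin n) (Fin n) ℂ := Matrix.diagonal fun k => if k.val = 0 then 1 else 0
      have hQ : Q * Q = Q := by simp [Q]
      have hQh : Q.IsHermitian := by
        refine Matrix.isHermitian_diagonal_iff.2 fun k => ?_
        by_cases hk : k.val = 0 <;> simp [hk, IsSelfAdjoint]
      have hQ1 : Q ≠ 1 := fun h => by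
        have := congrFun (congrFun h ⟨1, by omega⟩) ⟨1, by omega⟩
        simp [Q] at this
      have hQ0 : 1 - Q ≠ 1 := fun h => by
        have h := sub_eq_self.1 h
        have := congrFun (congrFun h ⟨0, by omega⟩) ⟨0, by omega⟩
        simp [Q] at this
      have v1 : ValidPair (α, Q) := ⟨hp.1, hQh, hQ⟩
      have v2 : ValidPair (α, 1 - Q) := ⟨hp.1, Matrix.isHermitian_one.sub hQh, by
        simp only [mul_sub, sub_mul, hQ]; simp⟩
      refine ⟨(α, Q) :: (α, 1 - Q) :: l', ?_, ?_, ?_⟩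
      · have e : basicGL (α, Q) v1 * basicGL (α, 1 - Q) v2 = basicGL (α, 1) hp :=
          Units.ext (basicLoop_mul_basicLoop_compl hQ)
        rw [← e, mul_assoc]
        exact (isFactorisation_singleton v1).append ((isFactorisation_singleton v2).append h1)
      · simpa [hQ1, hQ0] using h2
      · intro a ha
        simp only [List.map_cons, List.mem_cons] at ha ⊢
        rcases ha with ha | ha | ha
        · exact .inl ha
        · exact .inl ha
        · exact .inr (h3 a ha)
    · refine ⟨(α, P) :: l', (isFactorisation_singleton hp).append h1, ?_, ?_⟩
      · simpa [hP] using h2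
      · intro a ha
        simp only [List.map_cons, List.mem_cons] at ha ⊢
        exact ha.imp_right (h3 a)

lemma exists_inDomain_close {s u : Mero n} {l l' : List (ℂ × Matrix (Fin n) (Fin n) ℂ)}
    (hl : IsFactorisation l s) (hl' : IsFactorisation l' u) (h : ∀ a ∈ l.map Prod.fst, 0 < a.im)
    (h' : ∀ a ∈ l'.map Prod.fst, a.im < 0) {ε : ℝ} (hε : 0 < ε) :
    ∃ s' u', InDomain s' u' ∧ CloseOnReal ε s s' ∧ CloseOnReal ε u u' ∧
      ((∀ p ∈ l, p.2 ≠ 1) → NoScalarFactor s') ∧ ((∀ p ∈ l', p.2 ≠ 1) → NoScalarFactor u') := by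
  obtain ⟨s', h1, h2, h3, h4, h5⟩ := hl.exists_generic_close hε Set.finite_empty
  obtain ⟨u', k1, k2, k3, k4, k5⟩ := hl'.exists_generic_close hε
    ((finite_hasPole s').union ((finite_hasPole s').image (starRingEnd ℂ)))
  refine ⟨s', u', ⟨⟨h1, fun a ha hp => ?_⟩, ⟨k1, fun a ha hp => ?_⟩, h2, k2, ?_⟩, h3, k3, h5, k5⟩
  · obtain ⟨-, α, hα, hp⟩ := h4 a hp
    exact absurd hp (not_lt.2 (mul_nonpos_of_nonneg_of_nonpos (h α hα).le ha.le))
  · obtain ⟨-, α, hα, hp⟩ := k4 a hp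
    exact absurd hp (not_lt.2 (mul_nonpos_of_nonpos_of_nonneg (h' α hα).le ha.le))
  · refine Separated.symm fun a b ha hb => ⟨?_, ?_⟩
    · rintro rfl
      exact (k4 a ha).1 (.inl hb)
    · intro hab
      exact (k4 a ha).1 (.inr ⟨b, hb, hab.symm⟩)

/-! ### The main theorem -/

theorem operationsDenselyDefined (n : ℕ) : OperationsDenselyDefined n where
  exists_i x hx := by
    obtain ⟨l, hl⟩ := exists_isMinFactorisation hx
    exact ⟨_, isIImage_iff.2 ⟨l, hl, rfl⟩⟩
  unique_i x hx hg := ⟨_, (isIImage_iff_of_generic hx hg).2 rfl, fun _ hy =>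
    (isIImage_iff_of_generic hx hg).1 hy⟩
  exists_act s hs u hu := exists_isMinFactorsGM (mul_mem_loops hs.1 hu.1)
  unique_act s u h := by
    obtain ⟨p, hp⟩ := exists_isMinFactorsGM h.mul_mem_loops
    refine ⟨p, hp, fun q hq => ?_⟩
    have := (hq.poleFactors h.mul_mem_loops h.generic_mul).unique h.generic_mul
      (hp.poleFactors h.mul_mem_loops h.generic_mul)
    exact Prod.ext this.1 this.2
  dense s hs u hu ε hε := by
    obtain ⟨l, hl, h⟩ := exists_isFactorisation_of_mem_setM hs
    obtain ⟨l', hl', h'⟩ := exists_isFactorisation_of_mem_setG hu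
    obtain ⟨s', u', h1, h2, h3, -⟩ := exists_inDomain_close hl hl' h h' hε
    exact ⟨s', u', h1, h2, h3⟩
  dense_noScalarFactor hn s hs u hu ε hε := by
    obtain ⟨l, hl, h⟩ := exists_isFactorisation_of_mem_setM hs
    obtain ⟨l', hl', h'⟩ := exists_isFactorisation_of_mem_setG hu
    obtain ⟨m, hm, m1, m2⟩ := hl.exists_nonscalar hn
    obtain ⟨m', hm', m1', m2'⟩ := hl'.exists_nonscalar hn
    obtain ⟨s', u', h1, h2, h3, h4, h5⟩ := exists_inDomain_close hm hm'
      (fun a ha => h a (m2 a ha)) (fun a ha => h' a (m2' a ha)) hε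
    exact ⟨s', u', h1, h4 m1, h5 m1', h2, h3⟩

/-- The loops without poles in `H` form an almost group. -/
theorem isAlmostGroup_of_no_pole (H : Set ℂ) :
    IsAlmostGroup {φ : Mero n | φ ∈ loops n ∧ ∀ a, a ∈ H → ¬ HasPole φ a}
      {φ : Mero n | (φ ∈ loops n ∧ ∀ a, a ∈ H → ¬ HasPole φ a) ∧ IsScalar φ} := by
  have hmul : ∀ g h : Mero n, (g ∈ loops n ∧ ∀ a, a ∈ H → ¬ HasPole g a) →
      (h ∈ loops n ∧ ∀ a, a ∈ H → ¬ HasPole h a) →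
      g * h ∈ loops n ∧ ∀ a, a ∈ H → ¬ HasPole (g * h) a := fun g h hg hh =>
    ⟨mul_mem_loops hg.1 hh.1, fun a ha => not_hasPole_mul (hg.2 a ha) (hh.2 a ha)⟩
  have hi : ∀ g : Mero n, (g ∈ loops n ∧ ∀ a, a ∈ H → ¬ HasPole g a) → Generic g →
      iOp g ∈ loops n ∧ ∀ a, a ∈ H → ¬ HasPole (iOp g) a := fun g hg gg =>
    ⟨iOp_mem_loops hg.1 gg, fun a ha h => hg.2 a ha (hasPole_of_hasPole_iOp hg.1 gg h)⟩
  refine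
    { mul_mem := fun g hg h hh => hmul g h hg hh
      i_mem := fun g hg gg => ⟨hi g hg gg, generic_iOp hg.1 gg⟩
      i_bij := ?_
      J_subset := fun j hj => hj.1
      J_mul_mem := fun j hj k hk => ⟨hmul j k hj.1 hk.1, hj.2.mul hk.2⟩
      J_i_mem := fun j hj gj => ⟨hi j hj.1 gj, ?_⟩
      i_mul := fun g hg h hh gg gh hs => iOp_mul hg.1 hh.1 gg gh hs
      J_comm := fun g hg j hj => isScalar_mul_comm hj.2 g
      mul_i := fun g hg gg => ⟨?_, hmul g _ hg (hi g hg gg), ?_⟩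
      i_i := fun g hg gg gn => iOp_iOp hg.1 gg gn }
  · have hmaps : Set.MapsTo iOp
        {g : Mero n | (g ∈ loops n ∧ ∀ a, a ∈ H → ¬ HasPole g a) ∧ Generic g ∧ NoScalarFactor g}
        {g : Mero n | (g ∈ loops n ∧ ∀ a, a ∈ H → ¬ HasPole g a) ∧ Generic g ∧ NoScalarFactor g} :=
      fun g ⟨hg, gg, _⟩ => ⟨hi g hg gg, generic_iOp hg.1 gg, noScalarFactor_iOp hg.1 gg⟩
    have hinv : Set.LeftInvOn iOp iOp
        {g : Mero n | (g ∈ loops n ∧ ∀ a, a ∈ H → ¬ HasPole g a) ∧ Generic g ∧ NoScalarFactor g} :=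
      fun g ⟨hg, gg, gn⟩ => iOp_iOp hg.1 gg gn
    exact Set.InvOn.bijOn ⟨hinv, hinv⟩ hmaps hmaps
  · rw [iOp_eq hj.1.1 gj]
    exact (isScalar_scal _).mul hj.2.inv
  · rw [iOp_eq hg.1 gg, ← mul_assoc, ← scal_mul_comm, mul_assoc, mul_inv_cancel, mul_assoc,
      inv_mul_cancel]
  · rw [iOp_eq hg.1 gg, ← mul_assoc, ← scal_mul_comm, mul_assoc, mul_inv_cancel, mul_one]
    exact isScalar_scal _

/-! ### Poles of products within one half plane, and the matched pair. -/

lemma mul_mem_setG {u v : Mero n} (hu : u ∈ setG n) (hv : v ∈ setG n) : u * v ∈ setG n :=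
  ⟨mul_mem_loops hu.1 hv.1, fun a ha => not_hasPole_mul (hu.2 a ha) (hv.2 a ha)⟩

lemma mul_mem_setM {s t : Mero n} (hs : s ∈ setM n) (ht : t ∈ setM n) : s * t ∈ setM n :=
  ⟨mul_mem_loops hs.1 ht.1, fun a ha => not_hasPole_mul (hs.2 a ha) (ht.2 a ha)⟩

/-- A pole of a factor of `x * y` at which the inverse of the other factor is regular. -/
lemma hasPole_mul_of_left {x y : Mero n} (hy : y ∈ loops n) {a : ℂ} (h : ¬ HasPole y (conj a))
    (ha : HasPole x a) : HasPole (x * y) a := by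
  have h1 : HasPole (x * y * y⁻¹) a := by rwa [mul_inv_cancel_right]
  exact (hasPole_of_mul h1).resolve_right (by rwa [hasPole_inv hy])

lemma hasPole_mul_of_right {x y : Mero n} (hx : x ∈ loops n) {a : ℂ} (h : ¬ HasPole x (conj a))
    (ha : HasPole y a) : HasPole (x * y) a := by
  have h1 : HasPole (x⁻¹ * (x * y)) a := by rwa [inv_mul_cancel_left]
  exact (hasPole_of_mul h1).resolve_left (by rwa [hasPole_inv hx])

lemma Generic.of_mul_left {x y : Mero n} (hy : y ∈ loops n) (hg : Generic (x * y))
    (h : ∀ a, HasPole x a → ¬ HasPole y (conj a)) : Generic x := by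
  intro a ha
  have h1 := hg a (hasPole_mul_of_left hy (h a ha) ha)
  refine ⟨?_, fun h' => h1.2 (hasPole_mul_of_left hy (h _ h') h')⟩
  have := simplePole_mul_left (ψ := y⁻¹) h1.1 (by rw [hasPole_inv hy]; exact h a ha)
  rwa [mul_inv_cancel_right] at this

lemma Generic.of_mul_right {x y : Mero n} (hx : x ∈ loops n) (hg : Generic (x * y))
    (h : ∀ a, HasPole y a → ¬ HasPole x (conj a)) : Generic y := by
  intro a ha
  have h1 := hg a (hasPole_mul_of_right hx (h a ha) ha)
  refine ⟨?_, fun h' => h1.2 (hasPole_mul_of_right hx (h _ h') h')⟩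
  have := simplePole_mul_right (φ := x⁻¹) (by rw [hasPole_inv hx]; exact h a ha) h1.1
  rwa [inv_mul_cancel_left] at this

/-- Conjugation leaves the half plane, so poles cannot cancel between two elements of G. This is why
the factors of a generic product in G are generic without any separation hypothesis. -/
lemma setG_not_hasPole_conj {u v : Mero n} (hu : u ∈ setG n) (hv : v ∈ setG n) (a : ℂ)
    (ha : HasPole u a) : ¬ HasPole v (conj a) :=
  hv.2 _ (by simpa using im_neg_of_hasPole hu ha)

lemma setM_not_hasPole_conj {s t : Mero n} (hs : s ∈ setM n) (ht : t ∈ setM n) (a : ℂ)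
    (ha : HasPole s a) : ¬ HasPole t (conj a) :=
  ht.2 _ (by simpa using im_pos_of_hasPole hs ha)

theorem isMatchedPair (n : ℕ) : IsMatchedPair n where
  act_mem s u h := ⟨h.actions_spec.mem_setG, h.actions_spec.mem_setM, h.actions_spec.eq_mul⟩
  act_mul s u hu v hv h := by
    have pu : ∀ a, HasPole u a → HasPole (u * v) a := fun a ha =>
      hasPole_mul_of_left hv.1 (setG_not_hasPole_conj hu hv a ha) ha
    have pv : ∀ a, HasPole v a → HasPole (u * v) a := fun a ha =>
      hasPole_mul_of_right hu.1 (setG_not_hasPole_conj hv hu a ha) ha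
    have gu : Generic u := h.2.2.2.1.of_mul_left hv.1 (setG_not_hasPole_conj hu hv)
    have gv : Generic v := h.2.2.2.1.of_mul_right hu.1 (setG_not_hasPole_conj hv hu)
    have h1 : InDomain s u := h.mono h.1 hu h.2.2.1 gu (fun _ => id) pu
    have h2 : InDomain (ract s u) v := h.mono h1.actions.1 hv h1.actions.2.2.1 gv
      (fun _ ha => h1.hasPole_ract.1 ha) pv
    have h3 := h.actions_eq (u' := lact s u * lact (ract s u) v) (s' := ract (ract s u) v)
      { mem_setG := mul_mem_setG h1.actions.2.1 h2.actions.2.1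
        mem_setM := h2.actions.1
        eq_mul := by
          rw [mul_assoc, ← h2.actions_spec.eq_mul, ← mul_assoc, ← mul_assoc,
            ← h1.actions_spec.eq_mul]
        left := fun a ha => h.hasPole_mul_iff.2 (.inr ((hasPole_of_mul ha).elim
          (fun h' => pu a (h1.hasPole_lact.1 h')) fun h' => pv a (h2.hasPole_lact.1 h')))
        right := fun a ha => h.hasPole_mul_iff.2
          (.inl (h1.hasPole_ract.1 (h2.hasPole_ract.1 ha))) }
    exact ⟨h1, h2, h3.2, h3.1⟩
  mul_act s hs t ht u h := by
    have ps : ∀ a, HasPole s a → HasPole (s * t) a := fun a ha =>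
      hasPole_mul_of_left ht.1 (setM_not_hasPole_conj hs ht a ha) ha
    have pt : ∀ a, HasPole t a → HasPole (s * t) a := fun a ha =>
      hasPole_mul_of_right hs.1 (setM_not_hasPole_conj ht hs a ha) ha
    have gs : Generic s := h.2.2.1.of_mul_left ht.1 (setM_not_hasPole_conj hs ht)
    have gt : Generic t := h.2.2.1.of_mul_right hs.1 (setM_not_hasPole_conj ht hs)
    have h1 : InDomain t u := h.mono ht h.2.1 gt h.2.2.2.1 pt (fun _ => id)
    have h2 : InDomain s (lact t u) := h.mono hs h1.actions.2.1 gs h1.actions.2.2.2.1 ps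
      (fun _ ha => h1.hasPole_lact.1 ha)
    have h3 := h.actions_eq (u' := lact s (lact t u)) (s' := ract s (lact t u) * ract t u)
      { mem_setG := h2.actions.2.1
        mem_setM := mul_mem_setM h2.actions.1 h1.actions.1
        eq_mul := by
          rw [← mul_assoc, ← h2.actions_spec.eq_mul, mul_assoc, mul_assoc,
            ← h1.actions_spec.eq_mul]
        left := fun a ha => h.hasPole_mul_iff.2
          (.inr (h1.hasPole_lact.1 (h2.hasPole_lact.1 ha)))
        right := fun a ha => h.hasPole_mul_iff.2 (.inl ((hasPole_of_mul ha).elim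
          (fun h' => ps a (h2.hasPole_ract.1 h')) fun h' => pt a (h1.hasPole_ract.1 h'))) }
    exact ⟨h1, h2, h3.2, h3.1⟩
  act_i s u h := by
    have h1 := h.actions.iOp
    refine ⟨h1, h1.actions_eq ?_⟩
    -- Apply i, which reverses separated products, to both sides of s u = (s ▷ u)(s ◁ u). The right
    -- side is then a factorisation into G and M with the required poles.
    have e : iOp (ract s u) * iOp (lact s u) = iOp u * iOp s := by
      rw [← iOp_mul h.1.1 h.2.1.1 h.2.2.1 h.2.2.2.1 h.2.2.2.2,
        ← iOp_mul h.actions.2.1.1 h.actions.1.1 h.actions.2.2.2.1 h.actions.2.2.1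
          h.actions.2.2.2.2.symm, ← h.actions_spec.eq_mul]
    rw [e]
    exact h.iOp.poleFactors
  JM_act j hj u h := h.actions_eq (by
    rw [isScalar_mul_comm hj.2]
    exact h.poleFactors)
  act_JG s j hj h := h.actions_eq (by
    rw [← isScalar_mul_comm hj.2]
    exact h.poleFactors)

/-! ### The doublecross product as the loop group. -/

theorem doublecrossIsLoopGroup (n : ℕ) : DoublecrossIsLoopGroup n where
  subgroup := ⟨loopGroup n, rfl⟩
  image := by
    ext x
    constructor
    · rintro ⟨p, hp, rfl⟩
      exact mul_mem_loops hp.1.1 hp.2.1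
    · intro hx
      obtain ⟨u, hu, s, hs, rfl⟩ := exists_setG_mul_setM hx
      exact ⟨(u, s), ⟨hu, hs⟩, rfl⟩
  bijOn := by
    refine ⟨fun p (hp : InDomain p.2 p.1) => ⟨mul_mem_loops hp.2.1.1 hp.1.1, hp.generic_mul'⟩,
      fun p (hp : InDomain p.2 p.1) q (hq : InDomain q.2 q.1) hpq => ?_, fun x ⟨hx, hg⟩ => ?_⟩
    · have h1 : PoleFactors (p.1 * p.2) q.1 q.2 := by
        rw [show p.1 * p.2 = q.1 * q.2 from hpq]
        exact hq.poleFactors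
      have := hp.poleFactors.unique hp.generic_mul' h1
      exact Prod.ext this.1 this.2
    · obtain ⟨⟨u, s⟩, h⟩ := exists_isMinFactorsGM hx
      have h1 := h.poleFactors hx hg
      exact ⟨(u, s), h1.inDomain hg, h1.eq_mul.symm⟩
  mul u hu s hs v hv t ht h := by
    refine ⟨⟨mul_mem_setG hu h.actions.2.1, mul_mem_setM h.actions.1 ht⟩, ?_⟩
    change u * lact s v * (ract s v * t) = _
    rw [mul_assoc, ← mul_assoc (lact s v), ← h.actions_spec.eq_mul]
    group
  i u s h := by
    have h1 := h.iOp
    refine ⟨⟨h1.actions.2.1, h1.actions.1⟩, ?_⟩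
    rw [iOp_mul h.2.1.1 h.1.1 h.2.2.2.1 h.2.2.1 h.2.2.2.2.symm]
    exact h1.actions_spec.eq_mul.symm

/-! ### Inversion as a symmetry exchanging G and M. -/

lemma FactorsGM.inv {x u s : Mero n} {k : ℕ} (h : FactorsGM x u s k) :
    FactorsGM x⁻¹ s⁻¹ u⁻¹ k := by
  obtain ⟨hu, hs, rfl, l, l', hl, hl', rfl⟩ := h
  exact ⟨inv_mem_setG hs, inv_mem_setM hu, mul_inv_rev _ _, _, _, hl'.inv, hl.inv,
    by simp [add_comm]⟩

/-- Inversion matches the factorisations of x with those of x⁻¹ and keeps the number of basic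
factors, so minimality is preserved even where the factorisation is not unique. -/
lemma IsMinFactorsGM.inv {x u s : Mero n} (h : IsMinFactorsGM x u s) :
    IsMinFactorsGM x⁻¹ s⁻¹ u⁻¹ := by
  obtain ⟨k, hk, hmin⟩ := h
  refine ⟨k, hk.inv, fun u' s' k' h' => hmin s'⁻¹ u'⁻¹ k' ?_⟩
  simpa using h'.inv

theorem isMutuallyInverse (n : ℕ) : IsMutuallyInverse n where
  doublecross := doublecrossIsLoopGroup n
  inv_mem_G s hs := inv_mem_setG hs
  inv_mem_M u hu := inv_mem_setM hu
  inv_J := Set.InvOn.bijOn (f' := fun j => j⁻¹) ⟨fun j _ => inv_inv j, fun j _ => inv_inv j⟩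
    (fun _ hj => ⟨inv_mem_setM hj.1, hj.2.inv⟩) (fun _ hj => ⟨inv_mem_setG hj.1, hj.2.inv⟩)
  inv_i x hx hg := ⟨hg.inv hx, iOp_inv hx hg⟩
  inv_i_all x hx y := isIImage_inv_iff
  inv_act s u h := by
    have h1 : InDomain u⁻¹ s⁻¹ := by
      refine ⟨inv_mem_setM h.2.1, inv_mem_setG h.1, h.2.2.2.1.inv h.2.1.1, h.2.2.1.inv h.1.1,
        fun a b ha hb => ?_⟩
      rw [hasPole_inv h.2.1.1] at ha
      rw [hasPole_inv h.1.1] at hb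
      have h2 := h.2.2.2.2 _ _ hb ha
      constructor
      · rintro rfl
        exact h2.1 rfl
      · rintro rfl
        exact h2.2 (by simp)
    refine ⟨h1, h1.actions_eq ?_⟩
    have h2 := (isMinFactorsGM_iff h.mul_mem_loops h.generic_mul).2 h.actions_spec
    have h3 := h2.inv
    rw [mul_inv_rev] at h3
    exact h3.poleFactors h1.mul_mem_loops h1.generic_mul
  inv_act_all s hs u hu u' s' := by
    rw [← mul_inv_rev]
    exact ⟨IsMinFactorsGM.inv, fun h => by simpa using h.inv⟩

end

end MeroLoop

theorem mainTheorem6 (n : ℕ) :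
    MeroLoop.OperationsDenselyDefined n ∧
    MeroLoop.IsAlmostGroup (MeroLoop.setG n) (MeroLoop.setJG n) ∧
    MeroLoop.IsAlmostGroup (MeroLoop.setM n) (MeroLoop.setJM n) ∧
    MeroLoop.IsMatchedPair n ∧
    MeroLoop.IsMutuallyInverse n :=
  ⟨MeroLoop.operationsDenselyDefined n, MeroLoop.isAlmostGroup_of_no_pole {a | 0 < a.im},
    MeroLoop.isAlmostGroup_of_no_pole {a | a.im < 0}, MeroLoop.isMatchedPair n,
    MeroLoop.isMutuallyInverse n⟩
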